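/- A hypergraph consists of a set $V$ of hypervertices and a family $E$ of hyperedges, each a nonempty subset of $V$ (repetitions allowed), which together cover $V$. Let $H$ be a finite connected $(d,r)$-regular hypergraph (every hypervertex lies in exactly $d$ hyperedges, every hyperedge has exactly $r$ hypervertices) with $d\ge r\ge 2$. Put $n_1=|V|$, $n_2=|E|$, $q=(d-1)(r-1)$. Let $B_H$ be the bipartite incidence graph of $H$, $\chi(B_H)=|V(B_H)|-|E(B_H)|$, and let $A$ be the adjacency matrix of $H$: for $v\neq w$ the entry $A_{vw}$ is the number of hyperedges containing both $v$ and $w$, and $A_{vv}=0$. A closed path of length $k\ge1$ in $H$ is a sequence $(v_1,e_1,\dots,v_k,e_k,v_1)$ with $v_i,v_{i+1}\in e_i$ and $v_i\ne v_{i+1}$ (indices mod $k$); a prime cycle is a class, under cyclic permutation, of closed paths with $e_i\neq e_{i+1}$ for all $i$ (indices mod $k$) that are not an $m$-fold repetition, $m\ge2$, of a closed path. Let $\zeta_H(u)=\prod_{p}(1-u^{|p|})^{-1}$ (product over prime cycles, $|u|$ small) and let $D(u)=\det[I-(A-r+2)u+qu^2]$. Then $\zeta_H$ extends to a meromorphic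 function on $\mathbb C$ and the following hold, where a pole of multiplicity $0$ means neither a pole nor a zero. (1) Apart from the poles of the determinant factor $D(u)^{-1}$ (that is, for the function $\zeta_H(u)D(u)$), $\zeta_H$ has a pole at $u=1$ of multiplicity $-\chi(B_H)=n_1(d-1)-n_2=n_2(r-1)-n_1\ge 0$ and a pole at $u=-\frac1{r-1}$ of multiplicity $n_2-n_1\ge0$. Counting also the poles of $D(u)^{-1}$: if $(d,r)\ne(2,2)$, the total multiplicity of the pole of $\zeta_H$ at $u=1$ is $-\chi(B_H)+1$; and if $-d$ is not an eigenvalue of $A$, the total multiplicity of the pole of $\zeta_H$ at $u=-\frac1{r-1}$ is $n_2-n_1$. (2) Suppose $(d,r)\neq(2,2)$. Then $H$ is Ramanujan, i.e. every eigenvalue $\lambda\neq d(r-1)$ of $A$ satisfies $|\lambda-r+2|\le 2\sqrt{q}$, if and only if $D(u)^{-1}$ has simple poles at $u=1$ and at $u=\frac1q$ and all its other poles lie on the circle $|u|=\frac1{\sqrt q}$. -/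

import Mathlib

open Topology Filter

noncomputable section

/-- A hypergraph with hypervertex set `V` whose hyperedges are indexed by `E`; distinct indices may
carry the same set of hypervertices (hyperedges are allowed to repeat). Every hyperedge is nonempty
and the hyperedges cover `V`. -/
structure MultiHypergraph (V E : Type*) where
  edge : E → Finset V
  edge_nonempty : ∀ e, (edge e).Nonempty
  cover : ∀ v, ∃ e, v ∈ edge e

namespace MultiHypergraph

variable {V E : Type*}

/-- The associated bipartite graph `B_H`: a hypervertex and a hyperedge are adjacent when they are
incident. -/
def bipartiteGraph (H : MultiHypergraph V E) : SimpleGraph (V ⊕ E) where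
  Adj x y := (∃ v e, x = Sum.inl v ∧ y = Sum.inr e ∧ v ∈ H.edge e) ∨
    (∃ v e, x = Sum.inr e ∧ y = Sum.inl v ∧ v ∈ H.edge e)
  symm := by
    constructor
    rintro x y (⟨v, e, hx, hy, h⟩ | ⟨v, e, hx, hy, h⟩)
    · exact Or.inr ⟨v, e, hy, hx, h⟩
    · exact Or.inl ⟨v, e, hy, hx, h⟩
  loopless := by
    constructor
    rintro x (⟨v, e, hx, hy, -⟩ | ⟨v, e, hx, hy, -⟩) <;> simp [hx] at hy

/-- A hypergraph is connected when its associated bipartite graph is. -/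
def Connected (H : MultiHypergraph V E) : Prop := H.bipartiteGraph.Connected

/-- The Euler number `χ(B_H) = |V(B_H)| - |E(B_H)|`. -/
def eulerChar (H : MultiHypergraph V E) : ℤ :=
  (Nat.card (V ⊕ E) : ℤ) - (H.bipartiteGraph.edgeSet.ncard : ℤ)

/-- `(d, r)`-regularity: every hypervertex lies in `d` hyperedges and every hyperedge has `r`
hypervertices. -/
def IsRegular (H : MultiHypergraph V E) (d r : ℕ) : Prop :=
  (∀ v : V, Nat.card {e : E // v ∈ H.edge e} = d) ∧ ∀ e : E, (H.edge e).card = r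

/-- The adjacency matrix: the `(v, w)` entry is the number of paths `(v, x, w)` of length `2` in
`B_H` without backtracking, that is, with `v ≠ w`. -/
def adjMatrix (H : MultiHypergraph V E) (R : Type*) [NatCast R] : Matrix V V R :=
  fun v w => (Nat.card {x : V ⊕ E // H.bipartiteGraph.Adj (Sum.inl v) x ∧
    H.bipartiteGraph.Adj x (Sum.inl w) ∧ v ≠ w} : R)

/-- The spectrum of `H`, with multiplicities: the (real) eigenvalues of the symmetric adjacency
matrix. -/
def spectrum [Fintype V] [DecidableEq V] (H : MultiHypergraph V E) : Multiset ℝ :=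
  (H.adjMatrix ℝ).charpoly.roots

/-- The non-obvious eigenvalues of a `(d, r)`-regular hypergraph: the obvious eigenvalue is `-d`,
with multiplicity `|V| - |E|` when `|V| > |E|` (equivalently `d < r`); otherwise there is no obvious
eigenvalue (the subtraction of natural numbers is then `0`). -/
def nonObviousSpectrum [Fintype V] [DecidableEq V] [Fintype E] (H : MultiHypergraph V E) (d : ℕ) :
    Multiset ℝ :=
  H.spectrum - Multiset.replicate (Fintype.card V - Fintype.card E) (-(d : ℝ))

/-- Ramanujan hypergraphs: finite connected `(d, r)`-regular hypergraphs all of whose non-obvious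
eigenvalues `l ≠ d (r - 1)` satisfy `|l - r + 2| ≤ 2 √((d - 1) (r - 1))`. -/
def IsRamanujan [Fintype V] [DecidableEq V] [Fintype E] (H : MultiHypergraph V E) (d r : ℕ) :
    Prop :=
  H.Connected ∧ H.IsRegular d r ∧ ∀ l ∈ H.nonObviousSpectrum d, l ≠ (d : ℝ) * ((r : ℝ) - 1) →
    |l - (r : ℝ) + 2| ≤ 2 * Real.sqrt (((d : ℝ) - 1) * ((r : ℝ) - 1))

/-- The list `[(v₁, e₁), …, (v_k, e_k)]`, `k ≥ 1`, encodes the closed path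
`(v₁, e₁, v₂, e₂, …, v_k, e_k, v₁)` of length `k`: the hyperedge `e_i` leads from the hypervertex
`v_i` to another hypervertex `v_{i+1}` of `e_i` (indices modulo `k`). -/
def IsClosedPath (H : MultiHypergraph V E) (c : List (V × E)) : Prop :=
  c ≠ [] ∧ ∀ i j (hi : i < c.length) (hj : j < c.length), j = (i + 1) % c.length →
    (c.get ⟨i, hi⟩).1 ∈ H.edge (c.get ⟨i, hi⟩).2 ∧
      (c.get ⟨j, hj⟩).1 ∈ H.edge (c.get ⟨i, hi⟩).2 ∧ (c.get ⟨i, hi⟩).1 ≠ (c.get ⟨j, hj⟩).1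

/-- Hyperedge backtracking: some `(e, v, e)` occurs in `(v₁, e₁, …, v_k, e_k, v₁)`. -/
def HasBacktracking (c : List (V × E)) : Prop :=
  ∃ (i : ℕ) (hi : i < c.length) (hj : i + 1 < c.length),
    (c.get ⟨i, hi⟩).2 = (c.get ⟨i + 1, hj⟩).2

/-- The `m`-multiple `c ^ m` of a closed path. -/
def multiple (c : List (V × E)) (m : ℕ) : List (V × E) := (List.replicate m c).flatten

/-- Primitive cycles: closed paths without hyperedge backtracking, tail-less, and not a non-trivial
multiple of another closed path. -/
def IsPrimitiveCycle (H : MultiHypergraph V E) (c : List (V × E)) : Prop :=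
  H.IsClosedPath c ∧ ¬ HasBacktracking c ∧ ¬ HasBacktracking (multiple c 2) ∧
    ¬ ∃ b m, H.IsClosedPath b ∧ 2 ≤ m ∧ c = multiple b m

/-- Prime cycles: primitive cycles up to cyclic permutation (`Cycle` is the type of lists modulo
rotation). -/
def PrimeCycle (H : MultiHypergraph V E) : Type _ :=
  {p : Cycle (V × E) // ∃ c : List (V × E), H.IsPrimitiveCycle c ∧ (c : Cycle (V × E)) = p}

/-- The length of a prime cycle. -/
def PrimeCycle.length {H : MultiHypergraph V E} (p : H.PrimeCycle) : ℕ := p.1.length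

/-- `Z` is the generalized Ihara-Selberg zeta function of `H`, continued to the whole plane: it is
meromorphic on `ℂ` and, for `|u|` small, it is the (unconditionally convergent) Euler product
`∏ (1 - u ^ |p|)⁻¹` over the prime cycles. -/
def IsZetaFunction (H : MultiHypergraph V E) (Z : ℂ → ℂ) : Prop :=
  Meromorphic Z ∧
    ∀ᶠ u in 𝓝 (0 : ℂ), HasProd (fun p : H.PrimeCycle => (1 - u ^ p.length)⁻¹) (Z u)

/-- `det [I - (A - r + 2) u + q u ^ 2]` with `q = (d - 1) (r - 1)`. -/
def detFactor [Fintype V] [DecidableEq V] (H : MultiHypergraph V E) (d r : ℕ) (u : ℂ) : ℂ :=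
  (1 - u • (H.adjMatrix ℂ - ((r : ℂ) - 2) • (1 : Matrix V V ℂ)) +
    (((d : ℂ) - 1) * ((r : ℂ) - 1) * u ^ 2) • (1 : Matrix V V ℂ)).det

end MultiHypergraph

/-- `f` is meromorphic at `z` with a pole of multiplicity `m` there (no pole and no zero if
`m = 0`). -/
def HasPoleOfMultiplicity (f : ℂ → ℂ) (z : ℂ) (m : ℤ) : Prop :=
  MeromorphicAt f z ∧ meromorphicOrderAt f z = ((-m : ℤ) : WithTop ℤ)

/-- `f` is meromorphic at `z` with a pole there. -/
def IsPole (f : ℂ → ℂ) (z : ℂ) : Prop :=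
  MeromorphicAt f z ∧ meromorphicOrderAt f z < 0

end

/-!
The zeta function is the dynamical zeta function of a finite transition matrix, and a determinant
identity expresses the latter through the adjacency matrix.

Unrolling a closed path into a periodic sequence turns prime cycles into the periodic orbits of the
shift on the sequences of pairs `(v, e)` whose steps are not backtracking
(`MultiHypergraph.isPrimitiveCycle_iff`). Being no proper power means that the length is
the minimal period. If `T` is the matrix of these steps, `tr Tᵏ` counts the points of period
`k`, so that `-log det (1 - u T) = ∑ tr(Tᵏ) uᵏ / k` is a sum over periodic points.
Grouping the points by their orbit and exponentiating gives the Euler product: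
`∏ (1 - u ^ |p|)⁻¹ = det (1 - u T)⁻¹` for small `u` (`hasProd_primeWord`). The right-hand
side is meromorphic on the plane, and by the identity theorem every continuation agrees with it off
a discrete set.

A step changes first the hypervertex, then the hyperedge. Accordingly
`T = (B Bᵀ - P) (C Cᵀ - P)`, where `B` and `C` are the incidence matrices from incident pairs to
hyperedges and to hypervertices, and `P` is the projection to the incident pairs. Regularity gives
`Bᵀ B = r`, `Cᵀ C = d` and `Cᵀ B Bᵀ C = A + d`, and two applications of
`det (1 + X Y) = det (1 + Y X)` yield
`det (1 - u T) = (1 - u) ^ (-χ) (1 + (r - 1) u) ^ (n₂ - n₁) D(u)`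
(`MultiHypergraph.IsRegular.det_one_sub_transitionMatrix`). The multiplicities are read off from
this, since `D(u)` is the product of `1 - (l - r + 2) u + q u²` over the eigenvalues `l` of `A`. The
eigenvalue `d (r - 1)` contributes `(1 - u) (1 - q u)`; it is simple by connectedness
(`MultiHypergraph.IsRegular.exists_spectrum_eq_cons`), and no other eigenvalue contributes a zero at
`1` or `1 / q`. The Ramanujan condition says that the other quadratic factors have discriminant
`≤ 0`, which is equivalent to their roots lying on the circle `|u| = 1 / √q`.
-/

noncomputable section

/-! ### Powers of a matrix and roots of its characteristic polynomial -/

open Polynomial in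
lemma Matrix.det_aeval_eq_prod_roots_charpoly {n K : Type*} [Fintype n] [DecidableEq n] [Field K]
    [IsAlgClosed K] (A : Matrix n n K) (p : K[X]) :
    (aeval A p).det = (A.charpoly.roots.map p.eval).prod := by
  have hcard : A.charpoly.roots.card = Fintype.card n := by
    rw [← (IsAlgClosed.splits A.charpoly).natDegree_eq_card_roots, A.charpoly_natDegree_eq_dim]
  have hlin (a : K) : (aeval A (X - C a)).det = (A.charpoly.roots.map (X - C a).eval).prod := by
    have h1 : (aeval A (X - C a)).det = (-1) ^ Fintype.card n * A.charpoly.eval a := by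
      rw [Matrix.eval_charpoly, ← Matrix.det_neg]
      congr 1
      simp [Matrix.algebraMap_eq_diagonal, Matrix.scalar_apply, Pi.algebraMap_def]
    have h2 : A.charpoly.eval a = (A.charpoly.roots.map fun z => a - z).prod := by
      conv_lhs => rw [(IsAlgClosed.splits A.charpoly).eq_prod_roots_of_monic A.charpoly_monic]
      rw [eval_multiset_prod, Multiset.map_map]
      simp
    rw [h1, h2, ← hcard, ← Multiset.prod_replicate, ← Multiset.map_const',
      ← Multiset.prod_map_mul]
    simp
  have hprod (s : Multiset K) : (aeval A (s.map fun a => X - C a).prod).det =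
      (A.charpoly.roots.map (s.map fun a => X - C a).prod.eval).prod := by
    induction s using Multiset.induction with
    | empty => simp
    | cons a s ih =>
      simp only [Multiset.map_cons, Multiset.prod_cons, map_mul, Matrix.det_mul, ih, hlin,
        eval_mul, Multiset.prod_map_mul]
  have hp := (IsAlgClosed.splits p).eq_prod_roots
  rw [hp, map_mul, Matrix.det_mul, hprod]
  simp only [eval_mul, Multiset.prod_map_mul, eval_C, Multiset.map_const', Multiset.prod_replicate,
    hcard, aeval_C]
  simp [Matrix.algebraMap_eq_diagonal, Matrix.det_diagonal]

lemma Matrix.trace_pow_eq_sum_roots_charpoly {n K : Type*} [Fintype n] [DecidableEq n] [Field K]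
    [IsAlgClosed K] (A : Matrix n n K) (k : ℕ) :
    (A ^ k).trace = (A.charpoly.roots.map (· ^ k)).sum := by
  -- The value of the characteristic polynomial of `A ^ k` at `x` is `det p(A)` for `p = x - X ^ k`.
  have h : (A ^ k).charpoly =
      ((A.charpoly.roots.map (· ^ k)).map fun a => Polynomial.X - Polynomial.C a).prod := by
    refine Polynomial.funext fun x => ?_
    have := A.det_aeval_eq_prod_roots_charpoly (Polynomial.C x - Polynomial.X ^ k)
    rw [Matrix.eval_charpoly, Polynomial.eval_multiset_prod]
    simpa [Matrix.algebraMap_eq_diagonal, Matrix.scalar_apply, Pi.algebraMap_def,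
      Function.comp_def] using this
  rw [Matrix.trace_eq_sum_roots_charpoly, h, Polynomial.roots_multiset_prod_X_sub_C]

lemma Matrix.det_one_sub_smul_eq_prod_roots_charpoly {n K : Type*} [Fintype n] [DecidableEq n]
    [Field K] [IsAlgClosed K] (A : Matrix n n K) (u : K) :
    (1 - u • A).det = (A.charpoly.roots.map fun z => 1 - u * z).prod := by
  have := A.det_aeval_eq_prod_roots_charpoly (1 - Polynomial.C u * Polynomial.X)
  simpa [Algebra.smul_def] using this

/-- The logarithm of the reciprocal characteristic polynomial: `exp (∑ tr(Aᵏ) uᵏ / k)` is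
`det (1 - u A)⁻¹` as long as `|u|` is smaller than the inverse of the modulus of each eigenvalue. -/
lemma Matrix.exists_hasSum_trace_pow_exp_eq {n : Type*} [Fintype n] [DecidableEq n]
    (A : Matrix n n ℂ) : ∀ᶠ u in 𝓝 (0 : ℂ), ∃ L : ℂ,
      HasSum (fun k : ℕ => (A ^ (k + 1)).trace * u ^ (k + 1) / ((k + 1 : ℕ) : ℂ)) L ∧
      Complex.exp L = ((1 - u • A).det)⁻¹ := by
  have hsmall : ∀ᶠ u in 𝓝 (0 : ℂ), ∀ z ∈ A.charpoly.roots.toFinset, ‖u * z‖ < 1 := by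
    rw [Filter.eventually_all_finset]
    intro z _
    have : Tendsto (fun u : ℂ => ‖u * z‖) (𝓝 0) (𝓝 ‖(0 : ℂ) * z‖) := by
      apply Continuous.tendsto; fun_prop
    rw [zero_mul, norm_zero] at this
    exact this.eventually_lt_const one_pos
  filter_upwards [hsmall] with u hu
  simp only [Multiset.mem_toFinset] at hu
  rw [A.det_one_sub_smul_eq_prod_roots_charpoly]
  simp only [A.trace_pow_eq_sum_roots_charpoly]
  generalize A.charpoly.roots = s at hu
  induction s using Multiset.induction with
  | empty => exact ⟨0, by simp, by simp⟩
  | cons a s ih =>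
    obtain ⟨L, hL, hexp⟩ := ih fun z hz => hu z (Multiset.mem_cons_of_mem hz)
    have ha := hu a (Multiset.mem_cons_self a s)
    refine ⟨-Complex.log (1 - u * a) + L, ?_, ?_⟩
    · have h1 := (hasSum_nat_add_iff' 1).2 (Complex.hasSum_taylorSeries_neg_log ha)
      simp only [Finset.range_one, Finset.sum_singleton, Nat.cast_zero, div_zero, sub_zero] at h1
      refine (h1.add hL).congr_fun ?_
      intro k
      simp [mul_pow]
      ring
    · have hne : 1 - u * a ≠ 0 := by
        intro h
        rw [← sub_eq_zero.1 h] at ha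
        simp at ha
      rw [Complex.exp_add, hexp, Complex.exp_neg, Complex.exp_log hne]
      simp [mul_comm]

/-! ### Traces of powers as sums over cyclic words -/

lemma Matrix.pow_succ_apply_eq_sum_prod {n R : Type*} [Fintype n] [DecidableEq n] [CommSemiring R]
    (A : Matrix n n R) (k : ℕ) (i j : n) :
    (A ^ (k + 1)) i j =
      ∑ g : Fin k → n, ∏ t : Fin (k + 1),
        A (Fin.cons (α := fun _ => n) i g t) (Fin.snoc (α := fun _ => n) g j t) := by
  induction k generalizing i with
  | zero => simp [Fin.snoc]
  | succ k ih =>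
    rw [pow_succ', Matrix.mul_apply, ← (Fin.consEquiv fun _ => n).sum_comp, Fintype.sum_prod_type]
    refine Finset.sum_congr rfl fun a _ => ?_
    rw [ih, Finset.mul_sum]
    refine Finset.sum_congr rfl fun g _ => ?_
    rw [Fin.prod_univ_succ (n := k + 1)]
    change _ = A i (Fin.snoc (α := fun _ => n) (Fin.cons (α := fun _ => n) a g) j 0) *
      ∏ t : Fin (k + 1), A (Fin.cons (α := fun _ => n) a g t)
        (Fin.snoc (α := fun _ => n) (Fin.cons (α := fun _ => n) a g) j t.succ)
    rw [← Fin.cons_snoc_eq_snoc_cons]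
    simp only [Fin.cons_zero, Fin.cons_succ]

lemma Matrix.trace_pow_succ_eq_sum_prod {n R : Type*} [Fintype n] [DecidableEq n] [CommSemiring R]
    (A : Matrix n n R) (k : ℕ) :
    (A ^ (k + 1)).trace = ∑ g : Fin (k + 1) → n, ∏ t, A (g t) (g (t + 1)) := by
  rw [← (Fin.consEquiv fun _ => n).sum_comp, Fintype.sum_prod_type, Matrix.trace]
  refine Finset.sum_congr rfl fun i _ => ?_
  rw [Matrix.diag_apply, Matrix.pow_succ_apply_eq_sum_prod]
  refine Finset.sum_congr rfl fun g _ => Finset.prod_congr rfl fun t _ => ?_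
  simp only [Fin.consEquiv_apply]
  congr 1
  refine Fin.lastCases ?_ (fun s => ?_) t
  · simp
  · rw [Fin.snoc_castSucc, Fin.coeSucc_eq_succ, Fin.cons_succ]

/-! ### Periodic points of the shift -/

/-- The one-sided shift on sequences. -/
def seqShift {α : Type*} (f : ℕ → α) : ℕ → α := fun i => f (i + 1)

lemma seqShift_iterate {α : Type*} (n : ℕ) (f : ℕ → α) (i : ℕ) : seqShift^[n] f i = f (i + n) := by
  induction n generalizing f with
  | zero => rfl
  | succ n ih => rw [Function.iterate_succ_apply, ih, seqShift, add_assoc]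

lemma isPeriodicPt_seqShift {α : Type*} {n : ℕ} {f : ℕ → α} :
    Function.IsPeriodicPt seqShift n f ↔ Function.Periodic f n := by
  simp only [Function.IsPeriodicPt, Function.IsFixedPt, funext_iff, seqShift_iterate,
    Function.Periodic]

/-- The points of period `k + 1` of the shift on the sequences all of whose steps are in `R`. -/
abbrev ShiftFixed {α : Type*} (R : α → α → Prop) (k : ℕ) : Type _ :=
  {f : ℕ → α // Function.IsPeriodicPt seqShift (k + 1) f ∧ ∀ i, R (f i) (f (i + 1))}

/-- The periodic points of the shift on the sequences all of whose steps are in `R`. -/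
abbrev ShiftPeriodic {α : Type*} (R : α → α → Prop) : Type _ :=
  {f : ℕ → α // 0 < Function.minimalPeriod seqShift f ∧ ∀ i, R (f i) (f (i + 1))}

/-- A point of period `k + 1` is the same thing as a cyclic word of length `k + 1`. -/
def shiftFixedEquiv {α : Type*} (R : α → α → Prop) (k : ℕ) :
    ShiftFixed R k ≃ {g : Fin (k + 1) → α // ∀ t, R (g t) (g (t + 1))} where
  toFun f := ⟨fun t => f.1 t, fun t => by
    have h := f.2.2 t
    rw [← (isPeriodicPt_seqShift.1 f.2.1).map_mod_nat (t + 1)] at h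
    simpa [Fin.val_add] using h⟩
  invFun g := ⟨fun i => g.1 (Fin.ofNat (k + 1) i), by
    rw [isPeriodicPt_seqShift]
    intro i
    refine congrArg g.1 (Fin.ext ?_)
    simp [Fin.ofNat], fun i => by
    have h := g.2 (Fin.ofNat (k + 1) i)
    have h' : Fin.ofNat (k + 1) (i + 1) = Fin.ofNat (k + 1) i + 1 :=
      Fin.ext (by simp [Fin.ofNat, Fin.val_add])
    rwa [← h'] at h⟩
  left_inv f := by
    ext i
    exact (isPeriodicPt_seqShift.1 f.2.1).map_mod_nat i
  right_inv g := by
    ext t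
    simp

instance {α : Type*} [Finite α] (R : α → α → Prop) (k : ℕ) : Finite (ShiftFixed R k) :=
  Finite.of_equiv _ (shiftFixedEquiv R k).symm

/-- The transition matrix of a relation. -/
def transitionMatrix {α : Type*} (R : α → α → Prop) [DecidableRel R] : Matrix α α ℂ :=
  fun x y => if R x y then 1 else 0

lemma trace_transitionMatrix_pow {α : Type*} [Fintype α] [DecidableEq α] (R : α → α → Prop)
    [DecidableRel R] (k : ℕ) :
    ((transitionMatrix R) ^ (k + 1)).trace = Nat.card (ShiftFixed R k) := by
  rw [Matrix.trace_pow_succ_eq_sum_prod, Nat.card_congr (shiftFixedEquiv R k),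
    Nat.card_eq_fintype_card, Fintype.card_subtype]
  simp [transitionMatrix, Finset.prod_ite_zero]

/-- There are at most `|α| ^ k` cyclic words of length `k`, so the sum over all of them is dominated
by a geometric series for `|u| < 1 / |α|`. -/
lemma summable_shiftFixed {α : Type*} [Fintype α] (R : α → α → Prop) :
    ∀ᶠ u in 𝓝 (0 : ℂ),
      Summable fun x : Σ k, ShiftFixed R k => u ^ (x.1 + 1) / ((x.1 + 1 : ℕ) : ℂ) := by
  have hsmall : ∀ᶠ u in 𝓝 (0 : ℂ), ‖(Fintype.card α : ℂ) * u‖ < 1 := by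
    have : Tendsto (fun u : ℂ => ‖(Fintype.card α : ℂ) * u‖) (𝓝 0)
        (𝓝 ‖(Fintype.card α : ℂ) * 0‖) := by
      apply Continuous.tendsto; fun_prop
    rw [mul_zero, norm_zero] at this
    exact this.eventually_lt_const one_pos
  filter_upwards [hsmall] with u hu
  refine Summable.of_norm ?_
  rw [summable_sigma_of_nonneg fun _ => norm_nonneg _]
  refine ⟨fun k => Summable.of_finite, ?_⟩
  have hgeo := (summable_nat_add_iff 1).2 (summable_geometric_of_norm_lt_one hu).norm
  refine Summable.of_nonneg_of_le (fun k => tsum_nonneg fun _ => norm_nonneg _) (fun k => ?_) hgeo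
  simp only
  rw [tsum_const, nsmul_eq_mul]
  have hcard : (Nat.card (ShiftFixed R k) : ℝ) ≤ (Fintype.card α : ℝ) ^ (k + 1) := by
    rw [Nat.card_congr (shiftFixedEquiv R k)]
    exact_mod_cast (Finite.card_subtype_le _).trans (by simp)
  have hk : (1 : ℝ) ≤ ‖((k + 1 : ℕ) : ℂ)‖ := by
    rw [Complex.norm_natCast]
    exact_mod_cast Nat.le_add_left 1 k
  rw [norm_pow, norm_mul, mul_pow, norm_div, norm_pow, Complex.norm_natCast (Fintype.card α)]
  exact mul_le_mul hcard (div_le_self (by positivity) hk) (by positivity) (by positivity)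

lemma ShiftFixed.sigma_ext {α : Type*} {R : α → α → Prop} {x y : Σ k, ShiftFixed R k}
    (h₁ : x.1 = y.1) (h₂ : x.2.1 = y.2.1) : x = y := by
  obtain ⟨k, f, hf⟩ := x
  obtain ⟨l, g, hg⟩ := y
  simp only at h₁ h₂
  subst h₁ h₂
  rfl

/-- A point of period `k + 1` is a periodic point together with the quotient of `k + 1` by the
minimal period. -/
def shiftPeriodicProdEquiv {α : Type*} (R : α → α → Prop) :
    ShiftPeriodic R × ℕ ≃ Σ k, ShiftFixed R k :=
  Equiv.ofBijective (fun x => ⟨Function.minimalPeriod seqShift x.1.1 * (x.2 + 1) - 1, x.1.1, by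
    rw [Nat.sub_add_cancel (Nat.mul_pos x.1.2.1 x.2.succ_pos)]
    exact (Function.isPeriodicPt_minimalPeriod _ _).mul_const _, x.1.2.2⟩) <| by
    constructor
    · rintro ⟨⟨f, hf⟩, m⟩ ⟨⟨g, hg⟩, l⟩ h
      have h₂ : f = g := congrArg (fun x : Σ k, ShiftFixed R k => x.2.1) h
      subst h₂
      have h₁ : Function.minimalPeriod seqShift f * (m + 1) - 1 =
          Function.minimalPeriod seqShift f * (l + 1) - 1 :=
        congrArg (fun x : Σ k, ShiftFixed R k => x.1) h
      have h₃ := Nat.mul_pos hf.1 m.succ_pos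
      have h₄ := Nat.mul_pos hf.1 l.succ_pos
      have h₅ : Function.minimalPeriod seqShift f * (m + 1) =
          Function.minimalPeriod seqShift f * (l + 1) := by
        rw [← Nat.sub_add_cancel h₃, ← Nat.sub_add_cancel h₄]
        exact congrArg (· + 1) h₁
      have := Nat.eq_of_mul_eq_mul_left hf.1 h₅
      simp_all
    · rintro ⟨k, f, hf⟩
      obtain ⟨c, hc⟩ := hf.1.minimalPeriod_dvd
      have hc0 : c ≠ 0 := by rintro rfl; simp at hc
      refine ⟨⟨⟨f, hf.1.minimalPeriod_pos k.succ_pos, hf.2⟩, c - 1⟩,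
        ShiftFixed.sigma_ext ?_ rfl⟩
      simp only
      rw [Nat.sub_add_cancel (Nat.one_le_iff_ne_zero.2 hc0), ← hc, Nat.add_sub_cancel]

lemma shiftPeriodicProdEquiv_fst {α : Type*} {R : α → α → Prop} (x : ShiftPeriodic R × ℕ) :
    (shiftPeriodicProdEquiv R x).1 + 1 = Function.minimalPeriod seqShift x.1.1 * (x.2 + 1) :=
  Nat.sub_add_cancel (Nat.mul_pos x.1.2.1 x.2.succ_pos)

/-- `-log det (1 - u T)` as a sum over the periodic points of the shift. -/
lemma exists_hasSum_shiftPeriodic {α : Type*} [Fintype α] [DecidableEq α] (R : α → α → Prop)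
    [DecidableRel R] : ∀ᶠ u in 𝓝 (0 : ℂ), ∃ L : ℂ,
      HasSum (fun f : ShiftPeriodic R =>
        -Complex.log (1 - u ^ Function.minimalPeriod seqShift f.1) /
          (Function.minimalPeriod seqShift f.1 : ℂ)) L ∧
      Complex.exp L = ((1 - u • transitionMatrix R).det)⁻¹ := by
  have hsmall : ∀ᶠ u in 𝓝 (0 : ℂ), ‖u‖ < 1 := by
    filter_upwards [Metric.ball_mem_nhds (0 : ℂ) one_pos] with u hu
    simpa using hu
  filter_upwards [summable_shiftFixed R, (transitionMatrix R).exists_hasSum_trace_pow_exp_eq,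
    hsmall] with u hsum ⟨L, hL, hexp⟩ hu
  refine ⟨L, ?_, hexp⟩
  have := fun k => Fintype.ofFinite (ShiftFixed R k)
  -- Grouped by period, the sum over all pairs (period, point) is the sum of the traces.
  have h1 := hsum.hasSum.sigma fun k => hasSum_fintype _
  have h2 : ∑' x : Σ k, ShiftFixed R k, u ^ (x.1 + 1) / ((x.1 + 1 : ℕ) : ℂ) = L := by
    refine h1.unique ?_
    refine hL.congr_fun fun k => ?_
    simp [trace_transitionMatrix_pow, mul_div_assoc]
  -- Grouped by point, the multiples of its minimal period `n` contribute `-log (1 - u ^ n) / n`.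
  have h3 := hsum.hasSum
  rw [h2, ← (shiftPeriodicProdEquiv R).hasSum_iff] at h3
  refine h3.prod_fiberwise fun f => ?_
  set n := Function.minimalPeriod seqShift f.1 with hn
  have hn0 : n ≠ 0 := f.2.1.ne'
  have hun : ‖u ^ n‖ < 1 := by
    rw [norm_pow]
    exact pow_lt_one₀ (norm_nonneg _) hu hn0
  have h4 := (hasSum_nat_add_iff' 1).2 (Complex.hasSum_taylorSeries_neg_log hun)
  simp only [Finset.range_one, Finset.sum_singleton, Nat.cast_zero, div_zero, sub_zero] at h4
  refine (h4.div_const (n : ℂ)).congr_fun fun m => ?_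
  simp only [Function.comp, shiftPeriodicProdEquiv_fst]
  rw [← hn, pow_mul, Nat.cast_mul, div_div, mul_comm]

/-! ### Cyclic words and shift orbits -/

/-- The periodic sequence `w w w …` spelled by a nonempty word. -/
def unroll {α : Type*} (w : List α) (h : w ≠ []) : ℕ → α :=
  fun i => w[i % w.length]'(Nat.mod_lt _ (List.length_pos_iff.2 h))

section Unroll

variable {α : Type*}

lemma unroll_congr {c c' : List α} (h : c ≠ []) (e : c = c') : unroll c h = unroll c' (e ▸ h) := by
  subst e; rfl

lemma isPeriodicPt_unroll (c : List α) (h : c ≠ []) :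
    Function.IsPeriodicPt seqShift c.length (unroll c h) := by
  rw [isPeriodicPt_seqShift]
  intro i
  simp [unroll]

lemma unroll_of_lt (w : List α) (h : w ≠ []) {i : ℕ} (hi : i < w.length) : unroll w h i = w[i] := by
  simp [unroll, Nat.mod_eq_of_lt hi]

lemma eq_of_unroll_eq {c c' : List α} {h : c ≠ []} {h' : c' ≠ []} (hl : c.length = c'.length)
    (hu : unroll c h = unroll c' h') : c = c' := by
  refine List.ext_getElem hl fun i hi hi' => ?_
  rw [← unroll_of_lt c h, ← unroll_of_lt c' h', hu]

lemma ofFn_ne_nil {n : ℕ} (hn : 0 < n) (f : ℕ → α) : List.ofFn (fun i : Fin n => f i) ≠ [] := by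
  simpa using hn.ne'

lemma unroll_ofFn {n : ℕ} (hn : 0 < n) {f : ℕ → α} (hf : Function.IsPeriodicPt seqShift n f) :
    unroll (List.ofFn fun i : Fin n => f i) (ofFn_ne_nil hn f) = f := by
  ext i
  simpa [unroll] using (isPeriodicPt_seqShift.1 hf).map_mod_nat i

lemma unroll_rotate (c : List α) (h : c ≠ []) (j : ℕ) :
    unroll (c.rotate j) (by simpa using h) = seqShift^[j] (unroll c h) := by
  ext i
  rw [seqShift_iterate]
  simp [unroll, List.getElem_rotate]

lemma length_flatten_replicate (b : List α) (m : ℕ) :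
    (List.replicate m b).flatten.length = m * b.length := by
  simp 

lemma flatten_replicate_ne_nil {b : List α} (h : b ≠ []) {m : ℕ} (hm : m ≠ 0) :
    (List.replicate m b).flatten ≠ [] := by
  rw [← List.length_pos_iff, length_flatten_replicate]
  exact Nat.mul_pos (Nat.pos_of_ne_zero hm) (List.length_pos_iff.2 h)

lemma getElem_flatten_replicate (b : List α) (h : b ≠ []) (m i : ℕ)
    (hi : i < (List.replicate m b).flatten.length) :
    (List.replicate m b).flatten[i] = unroll b h i := by
  induction m generalizing i with
  | zero => simp  at hi
  | succ m ih =>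
    have e : (List.replicate (m + 1) b).flatten = b ++ (List.replicate m b).flatten := by
      simp [List.replicate_succ]
    simp only [e, List.getElem_append]
    split_ifs with hib
    · rw [unroll_of_lt b h hib]
    · rw [ih, ← (isPeriodicPt_seqShift.1 (isPeriodicPt_unroll b h)) (i - b.length),
        Nat.sub_add_cancel (not_lt.1 hib)]

lemma unroll_flatten_replicate (b : List α) (h : b ≠ []) {m : ℕ} (hm : m ≠ 0) :
    unroll (List.replicate m b).flatten (flatten_replicate_ne_nil h hm) = unroll b h := by
  ext i
  rw [unroll, getElem_flatten_replicate b h]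
  simp [unroll]

/-- A word is a proper power exactly when the sequence it spells has a smaller period than its
length. -/
lemma minimalPeriod_unroll_eq_length_iff (c : List α) (h : c ≠ []) :
    Function.minimalPeriod seqShift (unroll c h) = c.length ↔
      ¬ ∃ b m, ∃ hb : b ≠ [],
        unroll b hb = unroll c h ∧ 2 ≤ m ∧ c = (List.replicate m b).flatten := by
  have hc := List.length_pos_iff.2 h
  have hper := isPeriodicPt_unroll c h
  constructor
  · rintro hmin ⟨b, m, hb, hub, hm, hcb⟩
    have h1 := (isPeriodicPt_unroll b hb).minimalPeriod_le (List.length_pos_iff.2 hb)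
    have h2 : c.length = m * b.length := by rw [hcb, length_flatten_replicate]
    rw [hub, hmin, h2] at h1
    have := List.length_pos_iff.2 hb
    nlinarith
  · intro hno
    have hg := hper.minimalPeriod_pos hc
    obtain ⟨m, hm⟩ := hper.minimalPeriod_dvd
    have hb := unroll_ofFn hg (Function.isPeriodicPt_minimalPeriod _ _)
    by_contra hne
    have hm0 : m ≠ 0 := by rintro rfl; simp at hm; exact h hm
    have hm1 : m ≠ 1 := by rintro rfl; exact hne (by simpa using hm.symm)
    refine hno ⟨_, m, ofFn_ne_nil hg _, hb, by omega, ?_⟩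
    refine eq_of_unroll_eq (h := h) (h' := flatten_replicate_ne_nil (ofFn_ne_nil hg _) hm0) ?_ ?_
    · rw [length_flatten_replicate, List.length_ofFn, hm, mul_comm]
    · rw [unroll_flatten_replicate _ (ofFn_ne_nil hg _) hm0, hb]

/-- Words representing the prime orbits of the shift: all cyclic steps are in `R`, and the length is
the minimal period. -/
def IsPrimeWord (R : α → α → Prop) (c : List α) : Prop :=
  ∃ h : c ≠ [], (∀ i, R (unroll c h i) (unroll c h (i + 1))) ∧
    Function.minimalPeriod seqShift (unroll c h) = c.length

/-- The cyclic word spelled by one minimal period of a sequence. -/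
def shiftCycle (f : ℕ → α) : Cycle α :=
  (List.ofFn fun i : Fin (Function.minimalPeriod seqShift f) => f i : List α)

lemma length_shiftCycle (f : ℕ → α) :
    (shiftCycle f).length = Function.minimalPeriod seqShift f := by
  simp [shiftCycle]

lemma isPrimeWord_ofFn {R : α → α → Prop} (f : ShiftPeriodic R) :
    IsPrimeWord R
      (List.ofFn fun i : Fin (Function.minimalPeriod seqShift f.1) => f.1 i : List α) := by
  have h := unroll_ofFn f.2.1 (Function.isPeriodicPt_minimalPeriod seqShift f.1)
  refine ⟨ofFn_ne_nil f.2.1 f.1, ?_, ?_⟩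
  · rw [h]; exact f.2.2
  · rw [h, List.length_ofFn]

lemma shiftCycle_unroll {R : α → α → Prop} {c : List α} (hc : IsPrimeWord R c) :
    shiftCycle (unroll c hc.1) = c := by
  unfold shiftCycle
  congr 1
  have hpos : 0 < Function.minimalPeriod seqShift (unroll c hc.1) := by
    rw [hc.2.2]; exact List.length_pos_iff.2 hc.1
  refine eq_of_unroll_eq (h := ofFn_ne_nil hpos _) (h' := hc.1) ?_ ?_
  · rw [List.length_ofFn, hc.2.2]
  · exact unroll_ofFn hpos (Function.isPeriodicPt_minimalPeriod _ _)

lemma IsPrimeWord.rotate {R : α → α → Prop} {c : List α} (hc : IsPrimeWord R c) (j : ℕ) :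
    IsPrimeWord R (c.rotate j) := by
  refine ⟨by simpa using hc.1, ?_, ?_⟩
  · intro i
    rw [unroll_rotate _ hc.1, seqShift_iterate, seqShift_iterate, add_right_comm]
    exact hc.2.1 _
  · rw [unroll_rotate _ hc.1, Function.minimalPeriod_apply_iterate, hc.2.2, List.length_rotate]
    exact ⟨_, List.length_pos_iff.2 hc.1, isPeriodicPt_unroll c hc.1⟩

/-- The periodic points in the orbit of a prime word, one for each rotation of the word. -/
def IsPrimeWord.fiberEquiv {R : α → α → Prop} {c : List α} (hc : IsPrimeWord R c) :
    Fin c.length ≃ {f : ShiftPeriodic R // shiftCycle f.1 = c} :=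
  Equiv.ofBijective (fun i => ⟨⟨seqShift^[i] (unroll c hc.1), by
      rw [← unroll_rotate]
      have h := hc.rotate i
      refine ⟨?_, h.2.1⟩
      rw [h.2.2]
      exact List.length_pos_iff.2 h.1⟩, by
      simp only
      rw [← unroll_rotate, shiftCycle_unroll (hc.rotate i)]
      exact Quotient.sound ⟨c.length - i, by
        rw [List.rotate_rotate, Nat.add_sub_cancel' i.2.le, List.rotate_length]⟩⟩) <| by
    constructor
    · intro i j hij
      have h := congrArg (fun f => f.1.1) hij
      have := Function.iterate_injOn_Iio_minimalPeriod (f := seqShift) (x := unroll c hc.1)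
        (by simp [hc.2.2]) (by simp [hc.2.2]) h
      exact Fin.ext this
    · rintro ⟨f, hf⟩
      obtain ⟨j, hj⟩ : c ~r List.ofFn fun i : Fin (Function.minimalPeriod seqShift f.1) => f.1 i :=
        (Quotient.exact hf).symm
      have hpos := List.length_pos_iff.2 hc.1
      refine ⟨⟨j % c.length, Nat.mod_lt _ hpos⟩, Subtype.ext (Subtype.ext ?_)⟩
      simp only
      rw [← unroll_rotate, ← unroll_ofFn f.2.1 (Function.isPeriodicPt_minimalPeriod seqShift f.1)]
      refine (unroll_congr _ ?_)
      rw [List.rotate_mod, hj]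

end Unroll

/-- The Euler product over the prime orbits of a finite relation is the reciprocal of
`det (1 - u T)`, where `T` is the transition matrix. -/
theorem hasProd_primeWord {α : Type*} [Fintype α] [DecidableEq α] (R : α → α → Prop)
    [DecidableRel R] (Q : List α → Prop) (hQ : ∀ c, Q c ↔ IsPrimeWord R c) :
    ∀ᶠ u in 𝓝 (0 : ℂ), HasProd
      (fun p : {p : Cycle α // ∃ c, Q c ∧ (c : Cycle α) = p} => (1 - u ^ p.1.length)⁻¹)
      ((1 - u • transitionMatrix R).det)⁻¹ := by
  have hsmall : ∀ᶠ u in 𝓝 (0 : ℂ), ‖u‖ < 1 := by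
    filter_upwards [Metric.ball_mem_nhds (0 : ℂ) one_pos] with u hu
    simpa using hu
  filter_upwards [exists_hasSum_shiftPeriodic R, hsmall] with u ⟨L, hL, hexp⟩ hu
  let π (f : ShiftPeriodic R) : {p : Cycle α // ∃ c, Q c ∧ (c : Cycle α) = p} :=
    ⟨shiftCycle f.1, _, (hQ _).2 (isPrimeWord_ofFn f), rfl⟩
  have hL' := (Equiv.sigmaFiberEquiv π).hasSum_iff.2 hL
  -- The `|p|` periodic points in the orbit of `p` contribute `-log (1 - u ^ |p|) / |p|` each.
  have hprime : HasSum (fun p : {p : Cycle α // ∃ c, Q c ∧ (c : Cycle α) = p} =>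
      -Complex.log (1 - u ^ p.1.length)) L := by
    refine hL'.sigma fun p => ?_
    obtain ⟨_, c, hc, rfl⟩ := p
    have hw := (hQ c).1 hc
    have e : Fin c.length ≃ {f : ShiftPeriodic R // π f = ⟨(c : Cycle α), c, hc, rfl⟩} :=
      hw.fiberEquiv.trans (Equiv.subtypeEquivRight fun f => by simp [π, Subtype.ext_iff])
    rw [← e.hasSum_iff]
    have hlen (i) : Function.minimalPeriod seqShift (e i).1.1 = c.length := by
      have h := congrArg (fun p => p.1.length) (e i).2
      simpa [π, length_shiftCycle] using h
    have hpos : (c.length : ℂ) ≠ 0 := by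
      exact_mod_cast (List.length_pos_iff.2 hw.1).ne'
    convert hasSum_fintype fun _ : Fin c.length =>
      -Complex.log (1 - u ^ c.length) / (c.length : ℂ) using 1
    · ext i
      simp [Equiv.sigmaFiberEquiv, hlen]
    · simp
      field_simp
  have := hprime.cexp
  rw [hexp] at this
  refine this.congr_fun fun p => ?_
  obtain ⟨_, c, hc, rfl⟩ := p
  have hc0 : c.length ≠ 0 := (List.length_pos_iff.2 ((hQ c).1 hc).1).ne'
  have hne : 1 - u ^ c.length ≠ 0 := by
    intro h
    have h1 := pow_lt_one₀ (norm_nonneg u) hu hc0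
    rw [← norm_pow, ← sub_eq_zero.1 h, norm_one] at h1
    exact lt_irrefl _ h1
  simp [Complex.exp_neg, Complex.exp_log hne]

namespace MultiHypergraph

variable {V E : Type*}

@[simp] lemma bipartiteGraph_adj_inl_inr (H : MultiHypergraph V E) (v : V) (e : E) :
    H.bipartiteGraph.Adj (Sum.inl v) (Sum.inr e) ↔ v ∈ H.edge e := by
  simp [bipartiteGraph]

@[simp] lemma bipartiteGraph_adj_inr_inl (H : MultiHypergraph V E) (v : V) (e : E) :
    H.bipartiteGraph.Adj (Sum.inr e) (Sum.inl v) ↔ v ∈ H.edge e := by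
  simp [bipartiteGraph]

@[simp] lemma bipartiteGraph_adj_inl_inl (H : MultiHypergraph V E) (v w : V) :
    ¬ H.bipartiteGraph.Adj (Sum.inl v) (Sum.inl w) := by
  simp [bipartiteGraph]

@[simp] lemma bipartiteGraph_adj_inr_inr (H : MultiHypergraph V E) (e f : E) :
    ¬ H.bipartiteGraph.Adj (Sum.inr e) (Sum.inr f) := by
  simp [bipartiteGraph]

/-! ### Prime cycles as prime words -/

/-- The step from `(v, e)` to `(w, f)` in a path without hyperedge backtracking: `e` leads from `v`
to `w ≠ v`, and `f ≠ e` is the next hyperedge. The condition `w ∈ f` is imposed so that only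
incident pairs occur. -/
def Step (H : MultiHypergraph V E) (x y : V × E) : Prop :=
  x.1 ∈ H.edge x.2 ∧ y.1 ∈ H.edge x.2 ∧ x.1 ≠ y.1 ∧ y.1 ∈ H.edge y.2 ∧ x.2 ≠ y.2

instance [DecidableEq V] [DecidableEq E] (H : MultiHypergraph V E) : DecidableRel H.Step :=
  fun x y => by unfold Step; infer_instance

/-- In terms of the periodic sequence, a closed path imposes one and the same condition at every
index. -/
lemma isClosedPath_iff (H : MultiHypergraph V E) (c : List (V × E)) :
    H.IsClosedPath c ↔ ∃ h : c ≠ [], ∀ i,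
      (unroll c h i).1 ∈ H.edge (unroll c h i).2 ∧
      (unroll c h (i + 1)).1 ∈ H.edge (unroll c h i).2 ∧
      (unroll c h i).1 ≠ (unroll c h (i + 1)).1 := by
  constructor
  · rintro ⟨h, hc⟩
    refine ⟨h, fun i => ?_⟩
    have hpos := List.length_pos_iff.2 h
    exact hc (i % c.length) ((i + 1) % c.length) (Nat.mod_lt _ hpos) (Nat.mod_lt _ hpos)
      (by simp)
  · rintro ⟨h, hc⟩
    refine ⟨h, fun i j hi hj hij => ?_⟩
    have := hc i
    subst hij
    rw [unroll_of_lt c h hi] at this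
    exact this

/-- Backtracking in the square of a path is backtracking between cyclically consecutive steps. -/
lemma not_hasBacktracking_multiple_two_iff (c : List (V × E)) (h : c ≠ []) :
    ¬ HasBacktracking (multiple c 2) ↔ ∀ i, (unroll c h i).2 ≠ (unroll c h (i + 1)).2 := by
  have hpos := List.length_pos_iff.2 h
  have hlen : (multiple c 2).length = 2 * c.length := length_flatten_replicate c 2
  have hget (i : ℕ) (hi : i < (multiple c 2).length) : (multiple c 2)[i] = unroll c h i :=
    getElem_flatten_replicate c h 2 i hi
  unfold HasBacktracking
  simp only [List.get_eq_getElem, hget, not_exists, ne_eq]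
  constructor
  · intro hb i
    have hi := Nat.mod_lt i hpos
    have := hb (i % c.length) (by omega) (by omega)
    have hp := isPeriodicPt_seqShift.1 (isPeriodicPt_unroll c h)
    rw [← hp.map_mod_nat (i % c.length + 1), Nat.mod_add_mod, hp.map_mod_nat,
      hp.map_mod_nat] at this
    exact this
  · exact fun hb i _ _ => hb i

lemma isPrimitiveCycle_iff (H : MultiHypergraph V E) (c : List (V × E)) :
    H.IsPrimitiveCycle c ↔ IsPrimeWord H.Step c := by
  unfold IsPrimitiveCycle IsPrimeWord
  constructor
  · rintro ⟨hclosed, -, hback, hpow⟩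
    obtain ⟨h, hc⟩ := H.isClosedPath_iff c |>.1 hclosed
    rw [not_hasBacktracking_multiple_two_iff c h] at hback
    refine ⟨h, fun i => ⟨(hc i).1, (hc i).2.1, (hc i).2.2, (hc (i + 1)).1, hback i⟩, ?_⟩
    rw [minimalPeriod_unroll_eq_length_iff]
    rintro ⟨b, m, hb, hbc, hm, hcb⟩
    exact hpow ⟨b, m, H.isClosedPath_iff b |>.2 ⟨hb, hbc ▸ hc⟩, hm, hcb⟩
  · rintro ⟨h, hc, hmin⟩
    have hback := (not_hasBacktracking_multiple_two_iff c h).2 fun i => (hc i).2.2.2.2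
    refine ⟨H.isClosedPath_iff c |>.2 ⟨h, fun i => ⟨(hc i).1, (hc i).2.1, (hc i).2.2.1⟩⟩, ?_,
      hback, ?_⟩
    · rintro ⟨i, hi, hj, hij⟩
      refine (hc i).2.2.2.2 ?_
      rwa [unroll_of_lt c h hi, unroll_of_lt c h hj]
    · rintro ⟨b, m, hb, hm, hcb⟩
      refine (minimalPeriod_unroll_eq_length_iff c h).1 hmin ⟨b, m, hb.1, ?_, hm, hcb⟩
      rw [unroll_congr h hcb]
      exact (unroll_flatten_replicate b hb.1 (by omega)).symm

/-- The Euler product over the prime cycles is the reciprocal of `det (1 - u T)`, where `T` is the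
matrix of non-backtracking steps between incident pairs. -/
theorem hasProd_primeCycle [Fintype V] [DecidableEq V] [Fintype E] [DecidableEq E]
    (H : MultiHypergraph V E) :
    ∀ᶠ u in 𝓝 (0 : ℂ), HasProd (fun p : H.PrimeCycle => (1 - u ^ p.length)⁻¹)
      ((1 - u • transitionMatrix H.Step).det)⁻¹ :=
  hasProd_primeWord H.Step H.IsPrimitiveCycle H.isPrimitiveCycle_iff

/-! ### Counting incidences -/

lemma IsRegular.card_filter_mem [DecidableEq V] [Fintype E] {H : MultiHypergraph V E} {d r : ℕ}
    (hreg : H.IsRegular d r) (v : V) : (Finset.univ.filter fun e => v ∈ H.edge e).card = d := by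
  rw [← hreg.1 v, Nat.card_eq_fintype_card, Fintype.card_subtype]

section Counting

variable [Fintype V] [DecidableEq V] [Fintype E] {H : MultiHypergraph V E} {d r : ℕ}

lemma IsRegular.card_incidence (hreg : H.IsRegular d r) :
    (Finset.univ.filter fun x : V × E => x.1 ∈ H.edge x.2).card = Fintype.card V * d := by
  rw [Finset.card_filter, Fintype.sum_prod_type]
  simp_rw [← Finset.card_filter, hreg.card_filter_mem]
  simp

lemma IsRegular.card_incidence' (hreg : H.IsRegular d r) :
    (Finset.univ.filter fun x : V × E => x.1 ∈ H.edge x.2).card = Fintype.card E * r := by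
  rw [Finset.card_filter, Fintype.sum_prod_type_right]
  simp_rw [← Finset.card_filter]
  simp [hreg.2]

lemma ncard_edgeSet_bipartiteGraph (H : MultiHypergraph V E) :
    H.bipartiteGraph.edgeSet.ncard =
      (Finset.univ.filter fun x : V × E => x.1 ∈ H.edge x.2).card := by
  have himage : H.bipartiteGraph.edgeSet =
      (fun x : V × E => s(Sum.inl x.1, Sum.inr x.2)) '' {x | x.1 ∈ H.edge x.2} := by
    ext s
    induction s using Sym2.ind with
    | h x y =>
      rw [SimpleGraph.mem_edgeSet]
      rcases x with v | e <;> rcases y with w | f <;> simp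
  rw [himage, Set.ncard_image_of_injective]
  · rw [← Set.ncard_coe_finset]
    congr 1
    ext
    simp
  · rintro ⟨v, e⟩ ⟨w, f⟩ h
    simpa using h

lemma IsRegular.eulerChar_eq (hreg : H.IsRegular d r) :
    H.eulerChar = Fintype.card V + Fintype.card E - Fintype.card V * d := by
  unfold eulerChar
  rw [ncard_edgeSet_bipartiteGraph, hreg.card_incidence, Nat.card_eq_fintype_card,
    Fintype.card_sum]
  push_cast
  ring

end Counting

lemma adjMatrix_apply [DecidableEq V] [Fintype E] (H : MultiHypergraph V E) (R : Type*)
    [NatCast R] (v w : V) : H.adjMatrix R v w =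
      ((if v = w then 0 else
        (Finset.univ.filter fun e => v ∈ H.edge e ∧ w ∈ H.edge e).card : ℕ) : R) := by
  unfold adjMatrix
  congr 1
  split_ifs with h
  · subst h
    simp
  · rw [← Fintype.card_subtype, ← Nat.card_eq_fintype_card]
    refine (Nat.card_congr (Equiv.ofBijective (fun e => ⟨Sum.inr e.1, by simpa [h] using e.2⟩)
      ⟨?_, ?_⟩)).symm
    · rintro ⟨e, he⟩ ⟨f, hf⟩ hef
      simpa using hef
    · rintro ⟨x | e, hx⟩
      · simp at hx
      · exact ⟨⟨e, by simpa [h] using hx⟩, rfl⟩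

/-! ### The determinant formula -/

section Bass

open Matrix

/-- The matrix from incident pairs to hypervertices. Rows are indexed by all pairs; those of
non-incident pairs vanish. -/
def vertexIncidence [DecidableEq V] (H : MultiHypergraph V E) : Matrix (V × E) V ℂ :=
  fun x v => if x.1 = v ∧ x.1 ∈ H.edge x.2 then 1 else 0

lemma IsRegular.vertexIncidence_transpose_mul [Fintype V] [DecidableEq V] [Fintype E]
    {H : MultiHypergraph V E} {d r : ℕ} (hreg : H.IsRegular d r) :
    H.vertexIncidenceᵀ * H.vertexIncidence = (d : ℂ) • (1 : Matrix V V ℂ) := by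
  ext e f
  simp only [mul_apply, transpose_apply, vertexIncidence, Fintype.sum_prod_type, Matrix.smul_apply,
    one_apply, smul_eq_mul, mul_ite, mul_one, mul_zero]
  rw [Finset.sum_eq_single f (by simp +contextual) (by simp)]
  by_cases h : e = f
  · subst h
    simp [← hreg.card_filter_mem e, ← ite_and]
  · simp [h, Ne.symm h]

variable [Fintype V] [DecidableEq V] [Fintype E] [DecidableEq E]

/-- The matrix from incident pairs to hyperedges. Rows are indexed by all pairs; those of
non-incident pairs vanish. -/
def edgeIncidence (H : MultiHypergraph V E) : Matrix (V × E) E ℂ :=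
  fun x e => if x.2 = e ∧ x.1 ∈ H.edge x.2 then 1 else 0

/-- The projection onto the incident pairs. -/
def incidenceProj (H : MultiHypergraph V E) : Matrix (V × E) (V × E) ℂ :=
  diagonal fun x => if x.1 ∈ H.edge x.2 then 1 else 0

variable (H : MultiHypergraph V E)

lemma incidenceProj_mul_edgeIncidence : H.incidenceProj * H.edgeIncidence = H.edgeIncidence := by
  ext x e
  simp only [incidenceProj, diagonal_mul, edgeIncidence]
  by_cases h : x.1 ∈ H.edge x.2 <;> simp [h]

lemma incidenceProj_mul_vertexIncidence :
    H.incidenceProj * H.vertexIncidence = H.vertexIncidence := by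
  ext x v
  simp only [incidenceProj, diagonal_mul, vertexIncidence]
  by_cases h : x.1 ∈ H.edge x.2 <;> simp [h]

lemma edgeIncidence_transpose_mul_proj :
    H.edgeIncidenceᵀ * H.incidenceProj = H.edgeIncidenceᵀ := by
  have := congrArg transpose H.incidenceProj_mul_edgeIncidence
  rwa [transpose_mul, incidenceProj, diagonal_transpose] at this

lemma incidenceProj_mul_self : H.incidenceProj * H.incidenceProj = H.incidenceProj := by
  rw [incidenceProj, diagonal_mul_diagonal]
  congr 1
  ext x
  split_ifs <;> simp

variable {H} in
lemma IsRegular.edgeIncidence_transpose_mul {d r : ℕ} (hreg : H.IsRegular d r) :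
    H.edgeIncidenceᵀ * H.edgeIncidence = (r : ℂ) • (1 : Matrix E E ℂ) := by
  ext e f
  simp only [mul_apply, transpose_apply, edgeIncidence, Fintype.sum_prod_type_right,
    Matrix.smul_apply, one_apply, smul_eq_mul, mul_ite, mul_one, mul_zero]
  rw [Finset.sum_eq_single f (by simp +contextual) (by simp)]
  by_cases h : e = f
  · subst h
    simp [← hreg.2 e]
  · simp [h, Ne.symm h]

lemma edgeIncidence_transpose_mul_vertexIncidence (e : E) (v : V) :
    (H.edgeIncidenceᵀ * H.vertexIncidence) e v = if v ∈ H.edge e then 1 else 0 := by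
  simp only [mul_apply, transpose_apply, vertexIncidence, edgeIncidence, Fintype.sum_prod_type,
    mul_ite, mul_one, mul_zero]
  rw [Finset.sum_eq_single v (by simp +contextual) (by simp),
    Finset.sum_eq_single e (by simp +contextual) (by simp)]
  simp

variable {H} in
/-- The co-occurrence matrix of the hypervertices is `A + d`. -/
lemma IsRegular.incidence_transpose_mul {d r : ℕ} (hreg : H.IsRegular d r) :
    (H.edgeIncidenceᵀ * H.vertexIncidence)ᵀ * (H.edgeIncidenceᵀ * H.vertexIncidence) =
      H.adjMatrix ℂ + (d : ℂ) • (1 : Matrix V V ℂ) := by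
  ext v w
  rw [mul_apply]
  simp only [transpose_apply, edgeIncidence_transpose_mul_vertexIncidence, Matrix.add_apply,
    adjMatrix_apply, Matrix.smul_apply, one_apply]
  by_cases h : v = w
  · subst h
    simp [← hreg.card_filter_mem v, ← ite_and]
  · simp [h, ← Finset.sum_filter, Finset.filter_filter, and_comm]

/-- A step changes the hypervertex within the hyperedge and then the hyperedge at the new
hypervertex. -/
lemma transitionMatrix_step : transitionMatrix H.Step =
    (H.edgeIncidence * H.edgeIncidenceᵀ - H.incidenceProj) *
      (H.vertexIncidence * H.vertexIncidenceᵀ - H.incidenceProj) := by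
  have hX (x y : V × E) : (H.edgeIncidence * H.edgeIncidenceᵀ - H.incidenceProj) x y =
      if x.2 = y.2 ∧ x.1 ≠ y.1 ∧ x.1 ∈ H.edge x.2 ∧ y.1 ∈ H.edge y.2 then 1 else 0 := by
    rw [Matrix.sub_apply, mul_apply, Finset.sum_eq_single x.2]
    · simp only [edgeIncidence, incidenceProj, diagonal_apply, transpose_apply]
      obtain ⟨v, e⟩ := x
      obtain ⟨w, f⟩ := y
      by_cases h1 : e = f <;> by_cases h2 : v = w <;> by_cases h3 : v ∈ H.edge e <;>
        by_cases h4 : w ∈ H.edge f <;> simp_all [eq_comm]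
    · intro e _ he
      simp [edgeIncidence, he.symm]
    · simp
  have hY (x y : V × E) : (H.vertexIncidence * H.vertexIncidenceᵀ - H.incidenceProj) x y =
      if x.1 = y.1 ∧ x.2 ≠ y.2 ∧ x.1 ∈ H.edge x.2 ∧ y.1 ∈ H.edge y.2 then 1 else 0 := by
    rw [Matrix.sub_apply, mul_apply, Finset.sum_eq_single x.1]
    · simp only [vertexIncidence, incidenceProj, diagonal_apply, transpose_apply]
      obtain ⟨v, e⟩ := x
      obtain ⟨w, f⟩ := y
      by_cases h1 : e = f <;> by_cases h2 : v = w <;> by_cases h3 : v ∈ H.edge e <;>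
        by_cases h4 : w ∈ H.edge f <;> simp_all [eq_comm]
    · intro e _ he
      simp [vertexIncidence, he.symm]
    · simp
  ext ⟨v, e⟩ ⟨w, f⟩
  rw [mul_apply, Finset.sum_eq_single (w, e)]
  · rw [hX, hY]
    simp only [transitionMatrix, Step, ← ite_and, mul_ite, mul_one, mul_zero]
    congr 1
    simp only [eq_iff_iff]
    tauto
  · rintro ⟨a, b⟩ _ hab
    rw [hX, hY]
    by_cases h1 : e = b <;> by_cases h2 : a = w <;> simp_all
  · simp

variable {H} in
/-- Bass's formula `det (1 - u T) = (1 - u) ^ (-χ) (1 + (r - 1) u) ^ (n₂ - n₁) D(u)`, multiplied out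
so that all exponents are natural numbers. -/
theorem IsRegular.det_one_sub_transitionMatrix {d r : ℕ} (hreg : H.IsRegular d r) {u : ℂ}
    (ha : 1 - u ≠ 0) (hb : 1 + ((r : ℂ) - 1) * u ≠ 0) :
    (1 - u • transitionMatrix H.Step).det *
        ((1 - u) ^ (Fintype.card V + Fintype.card E) *
          (1 + ((r : ℂ) - 1) * u) ^ Fintype.card V) =
      (1 - u) ^ (Fintype.card V * d) * (1 + ((r : ℂ) - 1) * u) ^ Fintype.card E *
        H.detFactor d r u := by
  set a := 1 - u with hadef
  set b := 1 + ((r : ℂ) - 1) * u with hbdef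
  set B := H.edgeIncidence
  set C := H.vertexIncidence
  set P := H.incidenceProj
  set I := Bᵀ * C with hI
  -- With `G = 1 + u (B Bᵀ - P)`, the matrix `1 - u T` is `G` times a perturbation of the identity
  -- that factors through the hypervertices. The determinant of `G` reduces to the hyperedges by the
  -- Weinstein–Aronszajn identity.
  have hG : (1 + u • (B * Bᵀ - P)).det * a ^ Fintype.card E =
      a ^ (Fintype.card V * d) * b ^ Fintype.card E := by
    have h1 : 1 + u • (B * Bᵀ - P) = (1 - u • P) * (1 + (B * ((u / a) • Bᵀ))) := by
      have h2 : (1 - u • P) * B = a • B := by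
        rw [Matrix.sub_mul, smul_mul, H.incidenceProj_mul_edgeIncidence, Matrix.one_mul, hadef,
          sub_smul, one_smul]
      rw [Matrix.mul_add, ← Matrix.mul_assoc, h2, smul_mul, Matrix.mul_smul, smul_smul,
        mul_div_cancel₀ _ ha, smul_sub]
      simp only [Matrix.mul_one]
      abel
    have h3 : (1 - u • P).det = a ^ (Fintype.card V * d) := by
      have : 1 - u • P = diagonal fun x : V × E => if x.1 ∈ H.edge x.2 then a else 1 := by
        rw [← diagonal_one, show P = diagonal _ from rfl, ← diagonal_smul, diagonal_sub]
        congr 1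
        ext x
        split_ifs <;> simp_all
      rw [this, det_diagonal, Finset.prod_ite, Finset.prod_const, Finset.prod_const_one, mul_one,
        hreg.card_incidence]
    have h4 : (1 + (B * ((u / a) • Bᵀ))).det = (b / a) ^ Fintype.card E := by
      have h5 : 1 + (u / a) * (r : ℂ) = b / a := by
        field_simp
        rw [hadef, hbdef]
        ring
      rw [det_one_add_mul_comm, smul_mul, hreg.edgeIncidence_transpose_mul, smul_smul,
        ← h5]
      nth_rw 1 [← one_smul ℂ (1 : Matrix E E ℂ)]
      rw [← add_smul, det_smul, det_one, mul_one]
    rw [h1, det_mul, h3, h4, div_pow]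
    field_simp
  -- The vector multiplied by `G` is `G⁻¹ (B Bᵀ - P) C`.
  have hGC : (1 + u • (B * Bᵀ - P)) * (-(1 / a) • C + (1 / (a * b)) • (B * I)) =
      (B * Bᵀ - P) * C := by
    have h1 : (1 + u • (B * Bᵀ - P)) * C = a • C + u • (B * I) := by
      rw [Matrix.add_mul, smul_mul, Matrix.sub_mul, H.incidenceProj_mul_vertexIncidence,
        Matrix.mul_assoc, ← hI, hadef, smul_sub, sub_smul, Matrix.one_mul, one_smul]
      abel
    have h2 : (1 + u • (B * Bᵀ - P)) * B = b • B := by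
      rw [Matrix.add_mul, smul_mul, Matrix.sub_mul, H.incidenceProj_mul_edgeIncidence,
        Matrix.mul_assoc, hreg.edgeIncidence_transpose_mul, hbdef, Matrix.mul_smul,
        Matrix.mul_one, Matrix.one_mul]
      module
    rw [Matrix.mul_add, Matrix.mul_smul, Matrix.mul_smul, ← Matrix.mul_assoc, h1, h2, smul_mul,
      Matrix.sub_mul, H.incidenceProj_mul_vertexIncidence, Matrix.mul_assoc, ← hI]
    have h3 : (1 / (a * b)) * b - (1 / a) * u = 1 := by
      field_simp
      rw [hadef]
    have h4 : (1 / a) * a = 1 := by field_simp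
    calc _ = ((1 / (a * b)) * b - (1 / a) * u) • (B * I) - ((1 / a) * a) • C := by module
      _ = _ := by rw [h3, h4]; module
  have hT : 1 - u • transitionMatrix H.Step = (1 + u • (B * Bᵀ - P)) *
      (1 - (u • (-(1 / a) • C + (1 / (a * b)) • (B * I))) * Cᵀ) := by
    rw [Matrix.mul_sub, Matrix.mul_one, ← Matrix.mul_assoc, Matrix.mul_smul, hGC,
      H.transitionMatrix_step, Matrix.mul_sub, smul_sub, smul_mul, Matrix.mul_assoc _ C,
      Matrix.sub_mul _ _ P, H.incidenceProj_mul_self, Matrix.mul_assoc B,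
      H.edgeIncidence_transpose_mul_proj]
    module
  -- The same identity reduces the second factor to the hypervertices.
  have hD : (1 - (u • (-(1 / a) • C + (1 / (a * b)) • (B * I))) * Cᵀ).det *
      (a * b) ^ Fintype.card V = H.detFactor d r u := by
    have hCB : Cᵀ * (B * I) = H.adjMatrix ℂ + (d : ℂ) • (1 : Matrix V V ℂ) := by
      rw [← hreg.incidence_transpose_mul, ← Matrix.mul_assoc, hI, transpose_mul,
        transpose_transpose]
    rw [det_one_sub_mul_comm, Matrix.mul_smul, Matrix.mul_add, Matrix.mul_smul, Matrix.mul_smul,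
      hCB, hreg.vertexIncidence_transpose_mul, mul_comm, ← det_smul]
    unfold detFactor
    congr 1
    have h1 : (a * b) * (1 / a) = b := by field_simp
    have h2 : (a * b) * (1 / (a * b)) = 1 := by field_simp
    calc _ = (a * b + u * d * ((a * b) * (1 / a)) - u * d * ((a * b) * (1 / (a * b)))) •
          (1 : Matrix V V ℂ) - (u * ((a * b) * (1 / (a * b)))) • H.adjMatrix ℂ := by module
      _ = _ := by
        rw [h1, h2, hadef, hbdef]
        module
  rw [hT, det_mul, ← hD, mul_pow, pow_add]
  calc _ = (1 + u • (B * Bᵀ - P)).det * a ^ Fintype.card E *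
      ((1 - (u • (-(1 / a) • C + (1 / (a * b)) • (B * I))) * Cᵀ).det *
        (a ^ Fintype.card V * b ^ Fintype.card V)) := by ring
    _ = _ := by rw [hG]

end Bass

end MultiHypergraph

/-! ### Poles of meromorphic functions -/

lemma eventually_nhdsNE_ne (z w : ℂ) : ∀ᶠ u in 𝓝[≠] z, u ≠ w := by
  by_cases h : w = z
  · subst h
    exact self_mem_nhdsWithin
  · exact eventually_nhdsWithin_of_eventually_nhds (eventually_ne_nhds (Ne.symm h))

lemma hasPoleOfMultiplicity_of_eventuallyEq {f g : ℂ → ℂ} {z : ℂ} {m : ℕ} (hf : MeromorphicAt f z)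
    (hg : AnalyticAt ℂ g z) (hgz : g z ≠ 0)
    (hfg : ∀ᶠ u in 𝓝[≠] z, f u = ((u - z) ^ m * g u)⁻¹) : HasPoleOfMultiplicity f z m := by
  refine ⟨hf, (meromorphicOrderAt_eq_int_iff hf).2 ⟨fun u => (g u)⁻¹, hg.inv hgz,
    inv_ne_zero hgz, ?_⟩⟩
  filter_upwards [hfg] with u hu
  rw [hu, zpow_neg, zpow_natCast, mul_inv, smul_eq_mul]

/-- The identity theorem, for a meromorphic function on the plane. -/
lemma Meromorphic.eventuallyEq_zero {f : ℂ → ℂ} (hf : Meromorphic f) {z : ℂ}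
    (h : ∀ᶠ u in 𝓝[≠] z, f u = 0) (w : ℂ) : ∀ᶠ u in 𝓝[≠] w, f u = 0 := by
  rw [← meromorphicOrderAt_eq_top_iff] at h ⊢
  by_contra hw
  exact hf.exists_meromorphicOrderAt_ne_top_iff_forall.1 ⟨w, hw⟩ z h

lemma AnalyticAt.multiset_prod {ι : Type*} (s : Multiset ι) {f : ι → ℂ → ℂ} {z : ℂ}
    (hf : ∀ i, AnalyticAt ℂ (f i) z) : AnalyticAt ℂ (fun u => (s.map fun i => f i u).prod) z := by
  induction s using Multiset.induction with
  | empty => simpa using analyticAt_const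
  | cons a s ih =>
    simp only [Multiset.map_cons, Multiset.prod_cons]
    exact (hf a).mul ih

lemma Matrix.analyticAt_det_one_sub_smul {n : Type*} [Fintype n] [DecidableEq n] (A : Matrix n n ℂ)
    (z : ℂ) : AnalyticAt ℂ (fun u => (1 - u • A).det) z := by
  simp_rw [A.det_one_sub_smul_eq_prod_roots_charpoly]
  exact AnalyticAt.multiset_prod _ fun l => by fun_prop

/-- The reciprocal of an analytic function that vanishes nowhere near `z`, except perhaps at `z`,
has a pole exactly at a zero. -/
lemma isPole_inv_iff {f : ℂ → ℂ} {z : ℂ} (hf : AnalyticAt ℂ f z)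
    (hne : ∀ᶠ u in 𝓝[≠] z, f u ≠ 0) : IsPole (fun u => (f u)⁻¹) z ↔ f z = 0 := by
  constructor
  · rintro ⟨-, h⟩
    by_contra hz
    exact absurd (hf.inv hz).meromorphicOrderAt_nonneg (not_le.2 h)
  · intro hz
    refine ⟨hf.meromorphicAt.inv, ?_⟩
    have htop := (meromorphicOrderAt_ne_top_iff_eventually_ne_zero hf.meromorphicAt).2 hne
    have hpos : 0 < meromorphicOrderAt f z := by
      rw [← tendsto_zero_iff_meromorphicOrderAt_pos hf.meromorphicAt, ← hz]
      exact hf.continuousAt.tendsto.mono_left nhdsWithin_le_nhds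
    change meromorphicOrderAt f⁻¹ z < 0
    rw [meromorphicOrderAt_inv]
    lift meromorphicOrderAt f z to ℤ using htop with n hn
    norm_cast at hpos ⊢
    simpa using hpos

/-! ### Roots of a real quadratic polynomial -/

/-- The roots of a real polynomial `1 - t u + q u²` of nonpositive discriminant lie on the circle
`|u| = 1 / √q`: they are complex conjugate with product `1 / q`, or a real double root. -/
lemma norm_eq_of_quadratic_root {t q : ℝ} (hq : 0 < q) (ht : |t| ≤ 2 * √q) {z : ℂ}
    (hz : 1 - (t : ℂ) * z + q * z ^ 2 = 0) : ‖z‖ = 1 / √q := by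
  have hsq : t ^ 2 ≤ 4 * q := by
    have h := sq_le_sq' (abs_le.1 ht).1 (abs_le.1 ht).2
    rw [mul_pow, Real.sq_sqrt hq.le] at h
    linarith
  have hre := congrArg Complex.re hz
  have him := congrArg Complex.im hz
  simp [pow_two] at hre him
  have hn : q * (z.re ^ 2 + z.im ^ 2) = 1 := by
    by_cases hy : z.im = 0
    · rw [hy] at hre ⊢
      have h1 : (2 * q * z.re - t) ^ 2 = t ^ 2 - 4 * q := by nlinarith
      have h2 : 2 * q * z.re - t = 0 := by
        refine pow_eq_zero_iff (two_ne_zero) |>.1 (le_antisymm ?_ (sq_nonneg _))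
        rw [h1]
        linarith
      have h3 : t = 2 * q * z.re := by linarith
      rw [h3] at hre
      nlinarith
    · have h3 : t = 2 * q * z.re := by
        refine mul_right_cancel₀ hy ?_
        linarith
      rw [h3] at hre
      nlinarith
  have hnorm : ‖z‖ ^ 2 = (1 / √q) ^ 2 := by
    rw [div_pow, one_pow, Real.sq_sqrt hq.le, Complex.sq_norm, Complex.normSq_apply]
    field_simp
    linarith
  exact (pow_left_inj₀ (norm_nonneg _) (by positivity) two_ne_zero).1 hnorm

/-- The converse: a real polynomial `1 - t u + q u²` of positive discriminant has a root off the
circle `|u| = 1 / √q`. -/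
lemma exists_quadratic_root_norm_ne {t q : ℝ} (hq : 0 < q) (ht : 2 * √q < |t|) :
    ∃ z : ℂ, 1 - (t : ℂ) * z + q * z ^ 2 = 0 ∧ ‖z‖ ≠ 1 / √q := by
  have hsq : 4 * q < t ^ 2 := by
    have h := pow_lt_pow_left₀ ht (by positivity) two_ne_zero
    rw [mul_pow, Real.sq_sqrt hq.le, sq_abs] at h
    linarith
  have hs := Real.sq_sqrt (sub_pos.2 hsq).le
  set x := (t + √(t ^ 2 - 4 * q)) / (2 * q) with hx
  have hroot : 1 - t * x + q * x ^ 2 = 0 := by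
    rw [hx]
    field_simp
    linear_combination hs
  refine ⟨x, by exact_mod_cast congrArg (fun y : ℝ => (y : ℂ)) hroot, fun hn => ?_⟩
  have h1 : x ^ 2 * q = 1 := by
    rw [Complex.norm_real, Real.norm_eq_abs] at hn
    rw [← sq_abs, hn, div_pow, Real.sq_sqrt hq.le]
    field_simp
  have h2 : t * x = 2 := by linarith
  have h3 : t ^ 2 * x ^ 2 = 4 := by rw [← mul_pow, h2]; norm_num
  nlinarith [sq_nonneg x]

namespace MultiHypergraph

variable {V E : Type*}

/-! ### Eigenvalues and the determinant factor -/

lemma isHermitian_adjMatrix [DecidableEq V] [Fintype E] (H : MultiHypergraph V E) :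
    (H.adjMatrix ℝ).IsHermitian := by
  ext v w
  simp only [Matrix.conjTranspose_apply, adjMatrix_apply, star_trivial]
  simp only [eq_comm (a := w), and_comm (a := w ∈ _)]

section Spectral

variable [Fintype V] [DecidableEq V] [Fintype E] {H : MultiHypergraph V E} {d r : ℕ}

/-- The factor of `det [I - (A - r + 2) u + q u ^ 2]` at the eigenvalue `l`. -/
def eigenFactor (d r : ℕ) (l : ℝ) (u : ℂ) : ℂ :=
  1 - ((l : ℂ) - r + 2) * u + ((d : ℂ) - 1) * ((r : ℂ) - 1) * u ^ 2

lemma analyticAt_eigenFactor (l : ℝ) (z : ℂ) : AnalyticAt ℂ (eigenFactor d r l) z := by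
  unfold eigenFactor
  fun_prop

open Polynomial in
lemma detFactor_eq_prod_spectrum (H : MultiHypergraph V E) (d r : ℕ) (u : ℂ) :
    H.detFactor d r u = (H.spectrum.map fun l => eigenFactor d r l u).prod := by
  have hA : H.adjMatrix ℂ = (H.adjMatrix ℝ).map (algebraMap ℝ ℂ) := by
    ext v w
    simp [adjMatrix]
  have hroots : (H.adjMatrix ℂ).charpoly.roots = H.spectrum.map (algebraMap ℝ ℂ) := by
    rw [hA, Matrix.charpoly_map, spectrum,
      (H.isHermitian_adjMatrix.splits_charpoly).roots_map]
  have h := (H.adjMatrix ℂ).det_aeval_eq_prod_roots_charpoly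
    (1 - C u * (X - C ((r : ℂ) - 2)) + C (((d : ℂ) - 1) * ((r : ℂ) - 1) * u ^ 2))
  rw [hroots, Multiset.map_map] at h
  unfold detFactor
  refine (congrArg Matrix.det ?_).trans (h.trans (congrArg Multiset.prod ?_))
  · rw [map_add, map_sub, map_one, map_mul, map_sub, aeval_X, aeval_C, aeval_C, aeval_C]
    simp only [Algebra.algebraMap_eq_smul_one, smul_mul_assoc, one_mul]
  · refine Multiset.map_congr rfl fun l _ => ?_
    simp only [Function.comp, eval_add, eval_sub, eval_one, eval_mul, eval_C, eval_X, eigenFactor]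
    simp
    ring

lemma analyticAt_detFactor (H : MultiHypergraph V E) (d r : ℕ) (z : ℂ) :
    AnalyticAt ℂ (H.detFactor d r) z := by
  rw [show H.detFactor d r = _ from funext (H.detFactor_eq_prod_spectrum d r)]
  exact AnalyticAt.multiset_prod _ fun l => analyticAt_eigenFactor l z

/-- The determinant factor has isolated zeros, as it takes the value `1` at `0`. -/
lemma detFactor_eventually_ne_zero (H : MultiHypergraph V E) (d r : ℕ) (z : ℂ) :
    ∀ᶠ u in 𝓝[≠] z, H.detFactor d r u ≠ 0 := by
  have hm : Meromorphic (H.detFactor d r) := fun w => (H.analyticAt_detFactor d r w).meromorphicAt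
  have h0 : ∀ᶠ u in 𝓝[≠] (0 : ℂ), H.detFactor d r u ≠ 0 := by
    refine eventually_nhdsWithin_of_eventually_nhds
      ((H.analyticAt_detFactor d r 0).continuousAt.eventually_ne ?_)
    simp [detFactor]
  rw [← meromorphicOrderAt_ne_top_iff_eventually_ne_zero (hm _)] at h0 ⊢
  exact hm.exists_meromorphicOrderAt_ne_top_iff_forall.1 ⟨0, h0⟩ z

lemma detFactor_eq_zero_iff {u : ℂ} :
    H.detFactor d r u = 0 ↔ ∃ l ∈ H.spectrum, eigenFactor d r l u = 0 := by
  rw [detFactor_eq_prod_spectrum, Multiset.prod_eq_zero_iff, Multiset.mem_map]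

lemma IsRegular.sum_adjMatrix (hreg : H.IsRegular d r) (v : V) :
    ∑ w, H.adjMatrix ℝ v w = d * (r - 1) := by
  have h1 (w : V) : H.adjMatrix ℝ v w =
      (∑ e, if v ∈ H.edge e ∧ w ∈ H.edge e then 1 else 0) - if v = w then (d : ℝ) else 0 := by
    rw [adjMatrix_apply]
    split_ifs with h
    · subst h
      simp [hreg.card_filter_mem]
    · simp
  simp_rw [h1, Finset.sum_sub_distrib]
  rw [Finset.sum_comm]
  simp_rw [ite_and]
  have h2 (e : E) : (∑ w, if v ∈ H.edge e then (if w ∈ H.edge e then (1 : ℝ) else 0) else 0) =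
      if v ∈ H.edge e then (r : ℝ) else 0 := by
    split_ifs <;> simp [hreg.2]
  simp_rw [h2]
  rw [← Finset.sum_filter, Finset.sum_const, hreg.card_filter_mem]
  simp
  ring

/-- The maximum principle: an eigenfunction for the eigenvalue `d (r - 1)` of a connected hypergraph
is constant. -/
lemma IsRegular.eq_of_mulVec_eq (hreg : H.IsRegular d r) (hconn : H.Connected) {f : V → ℝ}
    (hf : (H.adjMatrix ℝ).mulVec f = ((d : ℝ) * (r - 1)) • f) (v w : V) : f v = f w := by
  have : Nonempty V := ⟨v⟩
  obtain ⟨m, hm⟩ := Finite.exists_max f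
  have hnbr {x y : V} {e : E} (hx : x ∈ H.edge e) (hy : y ∈ H.edge e) (hfx : f x = f m) :
      f y = f m := by
    by_cases hxy : x = y
    · rw [← hxy, hfx]
    have hsum : ∑ z, H.adjMatrix ℝ x z * (f m - f z) = 0 := by
      have h1 := congrFun hf x
      simp only [Matrix.mulVec, dotProduct, Pi.smul_apply, smul_eq_mul] at h1
      simp_rw [mul_sub, Finset.sum_sub_distrib]
      rw [h1, ← Finset.sum_mul, hreg.sum_adjMatrix, hfx, sub_self]
    have hterm := (Finset.sum_eq_zero_iff_of_nonneg fun z _ =>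
      mul_nonneg (by rw [adjMatrix_apply]; positivity) (sub_nonneg.2 (hm z))).1 hsum y
        (Finset.mem_univ _)
    rcases mul_eq_zero.1 hterm with h | h
    · rw [adjMatrix_apply, if_neg hxy, Nat.cast_eq_zero, Finset.card_eq_zero] at h
      have : e ∈ (∅ : Finset E) := by rw [← h]; simp [hx, hy]
      simp at this
    · linarith
  -- The incidence graph connects the maximum `m` to every hypervertex through hyperedges on which
  -- `f` is maximal.
  let Max : V ⊕ E → Prop := Sum.elim (fun x => f x = f m) fun e => ∀ x ∈ H.edge e, f x = f m
  have hstep {x y : V ⊕ E} (hxy : H.bipartiteGraph.Adj x y) (hx : Max x) : Max y := by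
    rcases x with x | e <;> rcases y with y | e' <;> simp at hxy
    · exact fun z hz => hnbr hxy hz hx
    · exact hx y hxy
  have hmax (x : V) : f x = f m := by
    have hreach := (SimpleGraph.reachable_iff_reflTransGen _ _).1
      (hconn.preconnected (Sum.inl m) (Sum.inl x))
    have : Max (Sum.inl x) := by
      generalize (Sum.inl x : V ⊕ E) = y at hreach
      induction hreach with
      | refl => exact rfl
      | tail _ h ih => exact hstep h ih
    exact this
  rw [hmax v, hmax w]

/-- The eigenvalue `d (r - 1)` of a connected hypergraph is simple. -/
lemma IsRegular.exists_spectrum_eq_cons (hreg : H.IsRegular d r) (hconn : H.Connected)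
    [Nonempty V] : ∃ s : Multiset ℝ, H.spectrum = ((d : ℝ) * (r - 1)) ::ₘ s ∧
      (d : ℝ) * (r - 1) ∉ s := by
  set k : ℝ := (d : ℝ) * (r - 1) with hk
  have hA := H.isHermitian_adjMatrix
  have hmem : k ∈ H.spectrum := by
    rw [spectrum, Polynomial.mem_roots (Matrix.charpoly_monic _).ne_zero,
      ← Matrix.mem_spectrum_iff_isRoot_charpoly, ← Matrix.spectrum_toLin',
      ← Module.End.hasEigenvalue_iff_mem_spectrum]
    refine Module.End.hasEigenvalue_of_hasEigenvector (x := fun _ => 1) ⟨?_, ?_⟩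
    · rw [Module.End.mem_eigenspace_iff]
      ext v
      simp [Matrix.mulVec, dotProduct, hreg.sum_adjMatrix, hk]
    · intro h
      have := congrFun h (Classical.arbitrary V)
      simp at this
  have hcount : H.spectrum.count k ≤ 1 := by
    rw [spectrum, hA.roots_charpoly_eq_eigenvalues, Multiset.count_map]
    change (Finset.univ.filter fun i => k = hA.eigenvalues i).card ≤ 1
    rw [Finset.card_le_one]
    intro i hi j hj
    rw [Finset.mem_filter] at hi hj
    by_contra hij
    -- Two eigenvectors for this eigenvalue are constant, hence not orthogonal.
    have hconst (i : V) (hi : k = hA.eigenvalues i) (v w : V) :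
        hA.eigenvectorBasis i v = hA.eigenvectorBasis i w :=
      hreg.eq_of_mulVec_eq hconn (by rw [hA.mulVec_eigenvectorBasis, ← hi]) v w
    have horth : inner ℝ (hA.eigenvectorBasis i) (hA.eigenvectorBasis j) = 0 :=
      hA.eigenvectorBasis.orthonormal.2 hij
    have hnorm (i : V) : hA.eigenvectorBasis i ≠ 0 := hA.eigenvectorBasis.orthonormal.ne_zero i
    let v₀ := Classical.arbitrary V
    have hne (i : V) (hi : k = hA.eigenvalues i) : hA.eigenvectorBasis i v₀ ≠ 0 := by
      intro h
      refine hnorm i ?_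
      ext v
      rw [hconst i hi v v₀, h]
      rfl
    rw [PiLp.inner_apply] at horth
    simp only [hconst i hi.2 _ v₀, hconst j hj.2 _ v₀] at horth
    simp [hne i hi.2, hne j hj.2] at horth
  obtain ⟨s, hs⟩ := Multiset.exists_cons_of_mem hmem
  refine ⟨s, hs, fun h => ?_⟩
  rw [hs, Multiset.count_cons_self] at hcount
  have := Multiset.count_pos.2 h
  omega

lemma eigenFactor_top (u : ℂ) : eigenFactor d r ((d : ℝ) * (r - 1)) u =
    (1 - u) * (1 - ((d : ℂ) - 1) * ((r : ℂ) - 1) * u) := by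
  unfold eigenFactor
  push_cast
  ring

lemma eigenFactor_one_ne_zero {l : ℝ} (hl : l ≠ (d : ℝ) * (r - 1)) : eigenFactor d r l 1 ≠ 0 := by
  intro h
  refine hl ?_
  have : ((1 - (l - r + 2) * 1 + (d - 1) * (r - 1) * 1 ^ 2 : ℝ) : ℂ) = 0 := by
    push_cast
    exact h
  have := Complex.ofReal_eq_zero.1 this
  linarith

lemma eigenFactor_inv_ne_zero {l : ℝ} (hl : l ≠ (d : ℝ) * (r - 1))
    (hq : ((d : ℂ) - 1) * ((r : ℂ) - 1) ≠ 0) :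
    eigenFactor d r l (1 / (((d : ℂ) - 1) * ((r : ℂ) - 1))) ≠ 0 := by
  intro h
  refine eigenFactor_one_ne_zero hl ?_
  -- `u ↦ 1 / (q u)` permutes the roots of the factor.
  have : eigenFactor d r l 1 = ((d : ℂ) - 1) * ((r : ℂ) - 1) *
      eigenFactor d r l (1 / (((d : ℂ) - 1) * ((r : ℂ) - 1))) := by
    unfold eigenFactor
    generalize ((d : ℂ) - 1) * ((r : ℂ) - 1) = q at hq
    field_simp
    ring
  rw [this, h, mul_zero]

lemma prod_eigenFactor_ne_zero {s : Multiset ℝ} {z : ℂ} (h : ∀ l ∈ s, eigenFactor d r l z ≠ 0) :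
    (s.map fun l => eigenFactor d r l z).prod ≠ 0 := by
  rw [Ne, Multiset.prod_eq_zero_iff, Multiset.mem_map]
  rintro ⟨l, hl, hz⟩
  exact h l hl hz

end Spectral

/-! ### The zeta function on the plane -/

section Zeta

variable [Fintype V] [DecidableEq V] [Fintype E] {H : MultiHypergraph V E} {d r : ℕ}

lemma isZetaFunction_inv_det [DecidableEq E] (H : MultiHypergraph V E) :
    H.IsZetaFunction fun u => ((1 - u • transitionMatrix H.Step).det)⁻¹ :=
  ⟨fun z => (Matrix.analyticAt_det_one_sub_smul _ z).meromorphicAt.inv, H.hasProd_primeCycle⟩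

/-- The continuation of the zeta function is unique up to its values on a discrete set. -/
lemma IsZetaFunction.eventually_eq_inv_det [DecidableEq E] {Z : ℂ → ℂ} (hZ : H.IsZetaFunction Z)
    (z : ℂ) : ∀ᶠ u in 𝓝[≠] z, Z u = ((1 - u • transitionMatrix H.Step).det)⁻¹ := by
  have hW := H.isZetaFunction_inv_det
  have h0 : ∀ᶠ u in 𝓝[≠] (0 : ℂ), Z u - ((1 - u • transitionMatrix H.Step).det)⁻¹ = 0 := by
    refine eventually_nhdsWithin_of_eventually_nhds ?_
    filter_upwards [hZ.2, hW.2] with u h1 h2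
    rw [h1.unique h2, sub_self]
  filter_upwards [Meromorphic.eventuallyEq_zero (fun w => (hZ.1 w).sub (hW.1 w)) h0 z] with u hu
  exact sub_eq_zero.1 hu

lemma IsRegular.card_le_card (hreg : H.IsRegular d r) (hr : 2 ≤ r) (hdr : r ≤ d) :
    Fintype.card V ≤ Fintype.card E := by
  have h := hreg.card_incidence.symm.trans hreg.card_incidence'
  refine Nat.le_of_mul_le_mul_right (c := r) ?_ (by omega)
  rw [← h]
  exact Nat.mul_le_mul_left _ hdr

/-- Equivalently `χ ≤ 0`. -/
lemma IsRegular.card_add_card_le (hreg : H.IsRegular d r) (hr : 2 ≤ r) (hdr : r ≤ d) :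
    Fintype.card V + Fintype.card E ≤ Fintype.card V * d := by
  have h := hreg.card_incidence.symm.trans hreg.card_incidence'
  refine Nat.le_of_mul_le_mul_right (c := r) ?_ (by omega)
  have h1 : r + d ≤ d * r := by nlinarith
  calc _ = Fintype.card V * (r + d) := by rw [add_mul, ← h]; ring
    _ ≤ _ := by rw [mul_assoc]; exact Nat.mul_le_mul_left _ h1

/-- The factorisation of the zeta function, away from a discrete set. -/
lemma IsZetaFunction.eventually_eq (hreg : H.IsRegular d r) (hr : 2 ≤ r) (hdr : r ≤ d)
    {Z : ℂ → ℂ} (hZ : H.IsZetaFunction Z) (z : ℂ) :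
    ∀ᶠ u in 𝓝[≠] z, H.detFactor d r u ≠ 0 ∧
      Z u = ((1 - u) ^ (Fintype.card V * d - (Fintype.card V + Fintype.card E)) *
        (1 + ((r : ℂ) - 1) * u) ^ (Fintype.card E - Fintype.card V) * H.detFactor d r u)⁻¹ := by
  classical
  have hr1 : (r : ℂ) - 1 ≠ 0 := by
    rw [sub_ne_zero]
    exact_mod_cast (by omega : r ≠ 1)
  filter_upwards [hZ.eventually_eq_inv_det z, H.detFactor_eventually_ne_zero d r z,
    eventually_nhdsNE_ne z 1, eventually_nhdsNE_ne z (-1 / ((r : ℂ) - 1))] with u hu hD h1 h2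
  refine ⟨hD, ?_⟩
  have ha : 1 - u ≠ 0 := sub_ne_zero.2 h1.symm
  have hb : 1 + ((r : ℂ) - 1) * u ≠ 0 := by
    intro h
    refine h2 ?_
    rw [eq_div_iff hr1]
    linear_combination h
  rw [hu]
  congr 1
  refine mul_right_cancel₀ (mul_ne_zero (pow_ne_zero (Fintype.card V + Fintype.card E) ha)
    (pow_ne_zero (Fintype.card V) hb)) ?_
  rw [hreg.det_one_sub_transitionMatrix ha hb]
  rw [← pow_sub_mul_pow _ (hreg.card_add_card_le hr hdr),
    ← pow_sub_mul_pow _ (hreg.card_le_card hr hdr)]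
  ring

lemma one_add_mul_eq {r : ℕ} (hr : 2 ≤ r) (u : ℂ) :
    1 + ((r : ℂ) - 1) * u = (u - -1 / ((r : ℂ) - 1)) * ((r : ℂ) - 1) := by
  have hr1 : (r : ℂ) - 1 ≠ 0 := by
    rw [sub_ne_zero]
    exact_mod_cast (by omega : r ≠ 1)
  field_simp
  ring

/-- The value of the determinant factor at `-1 / (r - 1)` is the product of `(l + d) / (r - 1)` over
the eigenvalues `l`. -/
lemma detFactor_neg_inv_ne_zero (hr : 2 ≤ r) (h : -(d : ℝ) ∉ H.spectrum) :
    H.detFactor d r (-1 / ((r : ℂ) - 1)) ≠ 0 := by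
  have hr1 : (r : ℂ) - 1 ≠ 0 := by
    rw [sub_ne_zero]
    exact_mod_cast (by omega : r ≠ 1)
  rw [Ne, detFactor_eq_zero_iff]
  rintro ⟨l, hl, hz⟩
  have h1 : ((l + d : ℝ) : ℂ) = 0 := by
    unfold eigenFactor at hz
    field_simp at hz
    push_cast
    linear_combination hz
  have h2 : l = -d := by linarith [Complex.ofReal_eq_zero.1 h1]
  exact h (h2 ▸ hl)

end Zeta

end MultiHypergraph

end

open MultiHypergraph in
theorem mainTheorem8 {V E : Type*} [Fintype V] [DecidableEq V] [Fintype E]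
    (H : MultiHypergraph V E) (d r : ℕ) (hreg : H.IsRegular d r) (hconn : H.Connected)
    (hr : 2 ≤ r) (hdr : r ≤ d) :
    -- the zeta function exists as a meromorphic function on the plane
    (∃ Z : ℂ → ℂ, H.IsZetaFunction Z) ∧
    -- the multiplicities are nonnegative and given by the stated formulas
    (0 ≤ -H.eulerChar ∧
      -H.eulerChar = (Fintype.card V : ℤ) * ((d : ℤ) - 1) - (Fintype.card E : ℤ) ∧
      -H.eulerChar = (Fintype.card E : ℤ) * ((r : ℤ) - 1) - (Fintype.card V : ℤ) ∧
      Fintype.card V ≤ Fintype.card E) ∧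
    (∀ Z : ℂ → ℂ, H.IsZetaFunction Z →
      -- poles of the zeta function apart from those of the determinant factor
      HasPoleOfMultiplicity (fun u => Z u * H.detFactor d r u) 1 (-H.eulerChar) ∧
      HasPoleOfMultiplicity (fun u => Z u * H.detFactor d r u) (-1 / ((r : ℂ) - 1))
        ((Fintype.card E : ℤ) - (Fintype.card V : ℤ)) ∧
      -- total multiplicities of these poles of the zeta function
      (3 ≤ d → HasPoleOfMultiplicity Z 1 (-H.eulerChar + 1)) ∧
      (-(d : ℝ) ∉ H.spectrum → HasPoleOfMultiplicity Z (-1 / ((r : ℂ) - 1))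
        ((Fintype.card E : ℤ) - (Fintype.card V : ℤ)))) ∧
    -- the Ramanujan condition and the poles of the determinant factor
    (3 ≤ d →
      (H.IsRamanujan d r ↔
        HasPoleOfMultiplicity (fun u => (H.detFactor d r u)⁻¹) 1 1 ∧
        HasPoleOfMultiplicity (fun u => (H.detFactor d r u)⁻¹)
          (1 / (((d : ℂ) - 1) * ((r : ℂ) - 1))) 1 ∧
        ∀ z : ℂ, IsPole (fun u => (H.detFactor d r u)⁻¹) z →
          z ≠ 1 → z ≠ 1 / (((d : ℂ) - 1) * ((r : ℂ) - 1)) →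
          ‖z‖ = 1 / Real.sqrt (((d : ℝ) - 1) * ((r : ℝ) - 1)))) := by
  classical
  have hVE := hreg.card_le_card hr hdr
  have hle := hreg.card_add_card_le hr hdr
  have hinc := hreg.card_incidence.symm.trans hreg.card_incidence'
  have : Nonempty V := by
    obtain ⟨v | e⟩ := hconn.nonempty
    · exact ⟨v⟩
    · exact ⟨(H.edge_nonempty e).choose⟩
  set m := Fintype.card V * d - (Fintype.card V + Fintype.card E) with hm
  set k := Fintype.card E - Fintype.card V with hk
  have hχ : -H.eulerChar = (m : ℤ) := by
    rw [hreg.eulerChar_eq, hm]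
    push_cast [hle]
    ring
  have hkZ : (Fintype.card E : ℤ) - (Fintype.card V : ℤ) = (k : ℤ) := by
    rw [hk]
    push_cast [hVE]
    ring
  have hr1 : (r : ℂ) - 1 ≠ 0 := by
    rw [sub_ne_zero]
    exact_mod_cast (by omega : r ≠ 1)
  have hr0 : (r : ℂ) ≠ 0 := by exact_mod_cast (by omega : r ≠ 0)
  have hd1 : (d : ℂ) - 1 ≠ 0 := by
    rw [sub_ne_zero]
    exact_mod_cast (by omega : d ≠ 1)
  have hq0 : ((d : ℂ) - 1) * ((r : ℂ) - 1) ≠ 0 := mul_ne_zero hd1 hr1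
  have hqpos : (0 : ℝ) < ((d : ℝ) - 1) * ((r : ℝ) - 1) := by
    have h1 : (2 : ℝ) ≤ r := by exact_mod_cast hr
    have h2 : (r : ℝ) ≤ d := by exact_mod_cast hdr
    exact mul_pos (by linarith) (by linarith)
  have hz1 : 1 - -1 / ((r : ℂ) - 1) ≠ 0 := by
    have : 1 - -1 / ((r : ℂ) - 1) = r / ((r : ℂ) - 1) := by field_simp; ring
    rw [this]
    exact div_ne_zero hr0 hr1
  have hb1 : 1 + ((r : ℂ) - 1) * 1 ≠ 0 := by simpa using hr0
  have hDan := H.analyticAt_detFactor d r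
  obtain ⟨s, hs, hsk⟩ := hreg.exists_spectrum_eq_cons hconn
  -- `D₁` is the product over the eigenvalues other than `d (r - 1)`.
  set D₁ : ℂ → ℂ := fun u => (s.map fun l => eigenFactor d r l u).prod with hD₁
  have hD₁an (z : ℂ) : AnalyticAt ℂ D₁ z :=
    AnalyticAt.multiset_prod _ fun l => analyticAt_eigenFactor l z
  have hD (u : ℂ) : H.detFactor d r u =
      (1 - u) * (1 - ((d : ℂ) - 1) * ((r : ℂ) - 1) * u) * D₁ u := by
    rw [detFactor_eq_prod_spectrum, hs, Multiset.map_cons, Multiset.prod_cons, eigenFactor_top]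
  have hD₁one : D₁ 1 ≠ 0 := prod_eigenFactor_ne_zero fun l hl =>
    eigenFactor_one_ne_zero (ne_of_mem_of_not_mem hl hsk)
  have hD₁inv : D₁ (1 / (((d : ℂ) - 1) * ((r : ℂ) - 1))) ≠ 0 := prod_eigenFactor_ne_zero fun l hl =>
    eigenFactor_inv_ne_zero (ne_of_mem_of_not_mem hl hsk) hq0
  have hq1 (h3 : 3 ≤ d) : 1 - ((d : ℂ) - 1) * ((r : ℂ) - 1) ≠ 0 := by
    intro h
    have h' : ((1 - (d - 1) * (r - 1) : ℝ) : ℂ) = 0 := by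
      push_cast
      exact h
    have h1 : (2 : ℝ) ≤ r := by exact_mod_cast hr
    have h2 : (3 : ℝ) ≤ d := by exact_mod_cast h3
    nlinarith [Complex.ofReal_eq_zero.1 h']
  refine ⟨⟨_, H.isZetaFunction_inv_det⟩, ⟨?_, ?_, ?_, hVE⟩, fun Z hZ => ⟨?_, ?_, ?_, ?_⟩, ?_⟩
  · rw [hχ]
    exact Int.natCast_nonneg m
  · rw [hreg.eulerChar_eq]
    ring
  · have : (Fintype.card V : ℤ) * d = Fintype.card E * r := by exact_mod_cast hinc
    rw [hreg.eulerChar_eq, this]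
    ring
  · rw [hχ]
    refine hasPoleOfMultiplicity_of_eventuallyEq
      (g := fun u => (-1) ^ m * (1 + ((r : ℂ) - 1) * u) ^ k)
      ((hZ.1 1).mul (hDan 1).meromorphicAt) (by fun_prop)
      (mul_ne_zero (pow_ne_zero _ (by norm_num)) (pow_ne_zero _ hb1)) ?_
    filter_upwards [hZ.eventually_eq hreg hr hdr 1] with u ⟨hu, hZu⟩
    rw [hZu, mul_inv _ (H.detFactor d r u), inv_mul_cancel_right₀ hu, ← mul_assoc, ← mul_pow]
    congr 3
    ring
  · rw [hkZ]
    refine hasPoleOfMultiplicity_of_eventuallyEq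
      (g := fun u => ((r : ℂ) - 1) ^ k * (1 - u) ^ m)
      ((hZ.1 _).mul (hDan _).meromorphicAt) (by fun_prop)
      (mul_ne_zero (pow_ne_zero _ hr1) (pow_ne_zero _ hz1)) ?_
    filter_upwards [hZ.eventually_eq hreg hr hdr _] with u ⟨hu, hZu⟩
    rw [hZu, mul_inv _ (H.detFactor d r u), inv_mul_cancel_right₀ hu, ← mul_assoc, ← mul_pow,
      ← one_add_mul_eq hr, mul_comm]
  · intro h3
    rw [hχ]
    refine hasPoleOfMultiplicity_of_eventuallyEq (m := m + 1)
      (g := fun u => (-1) ^ (m + 1) * ((1 + ((r : ℂ) - 1) * u) ^ k *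
        ((1 - ((d : ℂ) - 1) * ((r : ℂ) - 1) * u) * D₁ u)))
      (hZ.1 1) ?_ ?_ ?_
    · have := hD₁an 1
      fun_prop
    · refine mul_ne_zero (pow_ne_zero _ (by norm_num)) (mul_ne_zero (pow_ne_zero _ hb1)
        (mul_ne_zero ?_ hD₁one))
      rw [mul_one]
      exact hq1 h3
    · filter_upwards [hZ.eventually_eq hreg hr hdr 1] with u ⟨hu, hZu⟩
      rw [hZu, hD, ← mul_assoc ((u - 1) ^ (m + 1)), ← mul_pow]
      congr 1
      rw [show (u - 1) * -1 = 1 - u by ring]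
      ring
  · intro hspec
    rw [hkZ]
    refine hasPoleOfMultiplicity_of_eventuallyEq
      (g := fun u => ((r : ℂ) - 1) ^ k * ((1 - u) ^ m * H.detFactor d r u)) (hZ.1 _) ?_
      (mul_ne_zero (pow_ne_zero _ hr1) (mul_ne_zero (pow_ne_zero _ hz1)
        (detFactor_neg_inv_ne_zero hr hspec))) ?_
    · have := hDan (-1 / ((r : ℂ) - 1))
      fun_prop
    filter_upwards [hZ.eventually_eq hreg hr hdr _] with u ⟨hu, hZu⟩
    rw [hZu, ← mul_assoc, ← mul_pow, ← one_add_mul_eq hr]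
    congr 1
    ring
  · intro h3
    have hpole1 : HasPoleOfMultiplicity (fun u => (H.detFactor d r u)⁻¹) 1 1 := by
      refine hasPoleOfMultiplicity_of_eventuallyEq (m := 1)
        (g := fun u => -((1 - ((d : ℂ) - 1) * ((r : ℂ) - 1) * u) * D₁ u))
        (hDan 1).meromorphicAt.inv ?_ ?_ (Eventually.of_forall fun u => ?_)
      · have := hD₁an 1
        fun_prop
      · refine neg_ne_zero.2 (mul_ne_zero ?_ hD₁one)
        rw [mul_one]
        exact hq1 h3
      · rw [hD]
        congr 1
        ring
    have hpole2 : HasPoleOfMultiplicity (fun u => (H.detFactor d r u)⁻¹)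
        (1 / (((d : ℂ) - 1) * ((r : ℂ) - 1))) 1 := by
      refine hasPoleOfMultiplicity_of_eventuallyEq (m := 1)
        (g := fun u => -(((d : ℂ) - 1) * ((r : ℂ) - 1)) * ((1 - u) * D₁ u))
        (hDan _).meromorphicAt.inv ?_ ?_ (Eventually.of_forall fun u => ?_)
      · have := hD₁an (1 / (((d : ℂ) - 1) * ((r : ℂ) - 1)))
        fun_prop
      · refine mul_ne_zero (neg_ne_zero.2 hq0) (mul_ne_zero ?_ hD₁inv)
        intro h
        refine hq1 h3 ?_
        rw [sub_eq_zero, eq_comm, div_eq_one_iff_eq hq0] at h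
        rw [← h, sub_self]
      · rw [hD]
        congr 1
        generalize ((d : ℂ) - 1) * ((r : ℂ) - 1) = q at hq0
        field_simp
        ring
    have hcast : (((((d : ℝ) - 1) * ((r : ℝ) - 1) : ℝ)) : ℂ) = ((d : ℂ) - 1) * ((r : ℂ) - 1) := by
      push_cast
      rfl
    have hfac (l : ℝ) (z : ℂ) : eigenFactor d r l z =
        1 - ((l - r + 2 : ℝ) : ℂ) * z + ((((d : ℝ) - 1) * ((r : ℝ) - 1) : ℝ) : ℂ) * z ^ 2 := by
      rw [hcast]
      push_cast
      rfl
    have hns : H.nonObviousSpectrum d = H.spectrum := by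
      simp [nonObviousSpectrum, Nat.sub_eq_zero_of_le hVE]
    -- The poles at `1` and `1 / q` come from the eigenvalue `d (r - 1)` alone; the other poles are
    -- the roots of the quadratic factors of the other eigenvalues.
    constructor
    · rintro ⟨-, -, hram⟩
      refine ⟨hpole1, hpole2, fun z hz h1 h2 => ?_⟩
      rw [isPole_inv_iff (hDan z) (H.detFactor_eventually_ne_zero d r z),
        detFactor_eq_zero_iff] at hz
      obtain ⟨l, hl, hlz⟩ := hz
      by_cases hlk : l = (d : ℝ) * (r - 1)
      · rw [hlk, eigenFactor_top, mul_eq_zero] at hlz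
        rcases hlz with h | h
        · exact absurd (sub_eq_zero.1 h).symm h1
        · refine absurd ?_ h2
          rw [eq_div_iff hq0]
          linear_combination -h
      · rw [hfac] at hlz
        exact norm_eq_of_quadratic_root hqpos (hram l (hns ▸ hl) hlk) hlz
    · rintro ⟨-, -, hcircle⟩
      refine ⟨hconn, hreg, fun l hl hlk => ?_⟩
      rw [hns] at hl
      by_contra hlt
      obtain ⟨z, hz, hzn⟩ := exists_quadratic_root_norm_ne hqpos (not_le.1 hlt)
      rw [← hfac] at hz
      refine hzn (hcircle z ?_ ?_ ?_)
      · rw [isPole_inv_iff (hDan z) (H.detFactor_eventually_ne_zero d r z), detFactor_eq_zero_iff]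
        exact ⟨l, hl, hz⟩
      · rintro rfl
        exact eigenFactor_one_ne_zero hlk hz
      · rintro rfl
        exact eigenFactor_inv_ne_zero hlk hq0 hz
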